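/- **Setting.** Let $d=\log 3/\log 2$. Let $\Delta$ be the boundary of an equilateral triangle in the Euclidean plane with a horizontal bottom edge and side length $2\pi/3$, with vertices $v_0,v_1,v_2$ (lower left, lower right, top), and put $F_j(x)=\tfrac12(x+v_j)$. For a word $w\in\{0,1,2\}^n$, $n\ge 0$, put $\Delta_w=F_{w_1}\circ\dots\circ F_{w_n}(\Delta)$, a triangle of perimeter $2\pi 2^{-n}$, and let $\mathcal{SG}=\overline{\bigcup_{n}\bigcup_{w\in\{0,1,2\}^n}\Delta_w}$ be the Sierpinski gasket. Let $r_w:\mathbb R/2\pi2^{-n}\mathbb Z\to\Delta_w$ be the counterclockwise parametrization by arclength that starts at the lower right corner. For $|w|=n$ let $H_w=L^2(\mathbb R/2\pi 2^{-n}\mathbb Z)$ with the normalized Lebesgue measure, let $D_w$ be the self-adjoint operator on $H_w$ with $D_w\,e^{i2^nkx}=2^{n-1}(2k+1)\,e^{i2^nkx}$ for $k\in\mathbb Z$ (that is, $\frac1i\frac{d}{dx}+2^{n-1}$), and let $C(\mathcal{SG})$ act on $H_w$ by $\pi_w(f)\xi=(f\circ r_w)\,\xi$. Put $H_{\mathcal{SG}}=\bigoplus_w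 H_w$, $D_{\mathcal{SG}}=\bigoplus_w D_w$, $\pi_{\mathcal{SG}}=\bigoplus_w\pi_w$, the sums running over all finite words. For a bounded operator $T$ let $\mu_0(T)\ge\mu_1(T)\ge\cdots$ be its singular values (for compact $T$, the eigenvalues of $|T|$ with multiplicity). Let $\mathcal L^{(1,\infty)}$ be the ideal of the compact operators $T$ with $\sum_{j<N}\mu_j(T)=O(\log N)$. Let $\lim_\omega$ be any positive linear form on $\ell^\infty$ that extends the ordinary limit and satisfies $\lim_\omega(\alpha_1,\alpha_1,\alpha_2,\alpha_2,\dots)=\lim_\omega(\alpha_1,\alpha_2,\dots)$, and let $\mathrm{Tr}_\omega$ be the corresponding Dixmier trace: $\mathrm{Tr}_\omega(T)=\lim_\omega\frac1{\log N}\sum_{j<N}\mu_j(T)$ for positive $T\in\mathcal L^{(1,\infty)}$, extended linearly to $\mathcal L^{(1,\infty)}$. **Theorem 8.7.** The $d$-dimensional Hausdorff measure of $\mathcal{SG}$ is positive and finite, so that it has a normalization $\mu$ that is a probability measure on $\mathcal{SG}$. For every such $\mathrm{Tr}_\omega$ and every continuous function $f:\mathcal{SG}\to\mathbb C$, the operator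 $\pi_{\mathcal{SG}}(f)\,|D_{\mathcal{SG}}|^{-\log 3/\log 2}$ belongs to $\mathcal L^{(1,\infty)}$, and $\tau(f):=\mathrm{Tr}_\omega\big(\pi_{\mathcal{SG}}(f)\,|D_{\mathcal{SG}}|^{-\log 3/\log 2}\big)$ satisfies $$\tau(f)=\frac{4}{\log 3}\cdot\zeta\Big(\frac{\log 3}{\log 2}\Big)\cdot\int_{\mathcal{SG}}f\,d\mu=\frac{4}{\log 3}\cdot\zeta\Big(\frac{\log 3}{\log 2}\Big)\cdot\psi(f),$$ where $\zeta$ is the Riemann zeta function and $\psi(f)=\int_{\mathcal{SG}}f\,d\mu$. -/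

import Mathlib

open MeasureTheory Filter Topology
open scoped ENNReal NNReal

noncomputable section

namespace SG

/-! ### Singular values, the ideal `L^(1,∞)` and Dixmier traces -/

section Dixmier

variable {H : Type*} [NormedAddCommGroup H] [InnerProductSpace ℂ H] [CompleteSpace H]

/-- The `n`-th singular value (characteristic value) `μ_n(T)`, `n = 0, 1, 2, …`, of a bounded
operator: its distance to the set of operators of rank at most `n`.  For compact `T` this is the
`n`-th eigenvalue of `|T|`, in non-increasing order and counted with multiplicity. -/
def singularValue (T : H →L[ℂ] H) (n : ℕ) : ℝ :=
  sInf {c : ℝ | ∃ R : H →L[ℂ] H, LinearMap.rank (R : H →ₗ[ℂ] H) ≤ (n : Cardinal) ∧ c = ‖T - R‖}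

/-- `σ_N(T) = ∑_{j < N} μ_j(T)`. -/
def partialTrace (T : H →L[ℂ] H) (N : ℕ) : ℝ :=
  ∑ j ∈ Finset.range N, singularValue T j

/-- Membership in the Dixmier ideal `L^(1,∞)(H)`: `T` is compact and `σ_N(T) = O(log N)`. -/
def MemDixmierIdeal (T : H →L[ℂ] H) : Prop :=
  IsCompactOperator T ∧ ∃ C : ℝ, ∀ N : ℕ, 2 ≤ N → partialTrace T N ≤ C * Real.log N

/-- A form `lim_ω` on bounded sequences `(α_1, α_2, …)` as used to define a Dixmier trace.
The entry with index `m : ℕ` is `α_{m+1}`. -/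
structure DixmierLimit where
  /-- the linear form on `ℓ^∞` -/
  toLin : lp (fun _ : ℕ => ℝ) ∞ →ₗ[ℝ] ℝ
  /-- positivity -/
  nonneg : ∀ a : lp (fun _ : ℕ => ℝ) ∞, (∀ m, 0 ≤ a m) → 0 ≤ toLin a
  /-- it extends the ordinary limit -/
  eq_of_tendsto : ∀ (a : lp (fun _ : ℕ => ℝ) ∞) (L : ℝ),
    Tendsto (fun m => a m) atTop (𝓝 L) → toLin a = L
  /-- scale invariance: `lim_ω (α_1, α_1, α_2, α_2, …) = lim_ω (α_1, α_2, …)` -/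
  dilation : ∀ a b : lp (fun _ : ℕ => ℝ) ∞, (∀ m, b m = a (m / 2)) → toLin b = toLin a

open Classical in
/-- The value of `lim_ω` on a sequence (meaningful for bounded sequences). -/
def DixmierLimit.lim (ω : DixmierLimit) (a : ℕ → ℝ) : ℝ :=
  if h : Memℓp a ∞ then ω.toLin ⟨a, h⟩ else 0

/-- The Dixmier trace of a positive operator `T` in `L^(1,∞)`: `lim_ω` of `σ_N(T) / log N`.
The entry with index `m` belongs to `N = m + 1`; the single entry with `log N = 0` is irrelevant. -/
def dixmierTracePos (ω : DixmierLimit) (T : H →L[ℂ] H) : ℝ :=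
  ω.lim (fun m => partialTrace T (m + 1) / Real.log ((m + 1 : ℕ) : ℝ))

/-- The Dixmier trace `Tr_ω` on `L^(1,∞)(H)`: the linear extension of its values on positive
operators, through `T = (Re T)⁺ - (Re T)⁻ + i ((Im T)⁺ - (Im T)⁻)`. -/
def dixmierTrace (ω : DixmierLimit) (T : H →L[ℂ] H) : ℂ :=
  ((dixmierTracePos ω ((realPart T : H →L[ℂ] H)⁺)
      - dixmierTracePos ω ((realPart T : H →L[ℂ] H)⁻) : ℝ) : ℂ)
    + Complex.I *
      ((dixmierTracePos ω ((imaginaryPart T : H →L[ℂ] H)⁺)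
        - dixmierTracePos ω ((imaginaryPart T : H →L[ℂ] H)⁻) : ℝ) : ℂ)

end Dixmier

/-! ### Direct sums of operators -/

section DirectSum

variable {ι : Type*} {G : ι → Type*} [∀ i, NormedAddCommGroup (G i)]
  [∀ i, InnerProductSpace ℂ (G i)]

lemma memlp_of_bound (A : ∀ i, G i →L[ℂ] G i) {C : ℝ} (hA : ∀ i, ‖A i‖ ≤ C) :
    Memℓp A ∞ :=
  memℓp_infty ⟨C, by rintro _ ⟨i, rfl⟩; exact hA i⟩

/-- The bounded operator `⊕ A i` on the Hilbert sum of the `G i`, for a uniformly bounded family. -/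
def blockDiag (A : ∀ i, G i →L[ℂ] G i) {C : ℝ} (hA : ∀ i, ‖A i‖ ≤ C) : lp G 2 →L[ℂ] lp G 2 :=
  lp.holderL (p := ∞) (q := 2) 2 (fun i => ContinuousLinearMap.id ℂ (G i →L[ℂ] G i)) (K := 1)
    (fun i => (ContinuousLinearMap.norm_id_le : ‖ContinuousLinearMap.id ℂ (G i →L[ℂ] G i)‖ ≤ 1)) ⟨A, memlp_of_bound A hA⟩

lemma blockDiag_apply (A : ∀ i, G i →L[ℂ] G i) {C : ℝ} (hA : ∀ i, ‖A i‖ ≤ C)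
    (x : lp G 2) (i : ι) : blockDiag A hA x i = A i (x i) := rfl

lemma norm_blockDiag_le (A : ∀ i, G i →L[ℂ] G i) {C : ℝ} (hC : 0 ≤ C) (hA : ∀ i, ‖A i‖ ≤ C) :
    ‖blockDiag A hA‖ ≤ C := by
  have h1 := lp.norm_holderL_le (p := ∞) (q := 2) 2
    (fun i => ContinuousLinearMap.id ℂ (G i →L[ℂ] G i)) (K := 1)
    (fun i => (ContinuousLinearMap.norm_id_le : ‖ContinuousLinearMap.id ℂ (G i →L[ℂ] G i)‖ ≤ 1))
  have h2 := lp.norm_le_of_forall_le (E := fun i => G i →L[ℂ] G i)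
    (f := ⟨A, memlp_of_bound A hA⟩) hC hA
  exact (ContinuousLinearMap.le_of_opNorm_le_of_le _ h1 h2).trans_eq (one_mul C)

/-- The direct sum of unbounded operators, with domain the vectors `ξ` such that each `ξ i` is in
the domain of `D i` and `∑ ‖D i (ξ i)‖² < ∞`. -/
def directSumPMap (D : ∀ i, G i →ₗ.[ℂ] G i) : lp G 2 →ₗ.[ℂ] lp G 2 where
  domain :=
    { carrier := {x | ∃ h : ∀ i, x i ∈ (D i).domain, Memℓp (fun i => D i ⟨x i, h i⟩) 2}
      zero_mem' := by
        refine ⟨fun i => (D i).domain.zero_mem, ?_⟩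
        convert zero_memℓp (E := G) (p := 2) using 2 with i
        exact (D i).map_zero
      add_mem' := by
        rintro x y ⟨hx, hx'⟩ ⟨hy, hy'⟩
        refine ⟨fun i => (D i).domain.add_mem (hx i) (hy i), ?_⟩
        convert hx'.add hy' using 2 with i
        exact (D i).map_add ⟨x i, hx i⟩ ⟨y i, hy i⟩
      smul_mem' := by
        rintro c x ⟨hx, hx'⟩
        refine ⟨fun i => (D i).domain.smul_mem c (hx i), ?_⟩
        convert hx'.const_smul c using 2 with i
        exact (D i).map_smul c ⟨x i, hx i⟩ }
  toFun :=
    { toFun := fun x => ⟨fun i => D i ⟨x.1 i, x.2.1 i⟩, x.2.2⟩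
      map_add' := fun x y => by
        ext i
        exact (D i).map_add ⟨x.1 i, x.2.1 i⟩ ⟨y.1 i, y.2.1 i⟩
      map_smul' := fun c x => by
        ext i
        exact (D i).map_smul c ⟨x.1 i, x.2.1 i⟩ }

lemma directSumPMap_single [DecidableEq ι] (D : ∀ i, G i →ₗ.[ℂ] G i) (i : ι) (v : G i) (c : ℂ)
    (hv : v ∈ (D i).domain) (hc : D i ⟨v, hv⟩ = c • v) :
    ∃ h : lp.single 2 i v ∈ (directSumPMap D).domain,
      directSumPMap D ⟨lp.single 2 i v, h⟩ = c • lp.single 2 i v := by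
  have h1 : ∀ j, (lp.single 2 i v : lp G 2) j ∈ (D j).domain := by
    intro j
    by_cases hj : j = i
    · subst hj
      rwa [lp.single_apply_self]
    · rw [lp.single_apply_ne 2 i v hj]
      exact (D j).domain.zero_mem
  have h2 : ∀ j, D j ⟨(lp.single 2 i v : lp G 2) j, h1 j⟩ = (c • lp.single 2 i v : lp G 2) j := by
    intro j
    rw [lp.coeFn_smul, Pi.smul_apply]
    by_cases hj : j = i
    · subst hj
      have e : (⟨(lp.single 2 j v : lp G 2) j, h1 j⟩ : (D j).domain) = ⟨v, hv⟩ :=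
        Subtype.ext (lp.single_apply_self 2 j v)
      rw [e, hc, lp.single_apply_self]
    · have e : (⟨(lp.single 2 i v : lp G 2) j, h1 j⟩ : (D j).domain) = 0 :=
        Subtype.ext (lp.single_apply_ne 2 i v hj)
      rw [e, (D j).map_zero, lp.single_apply_ne 2 i v hj, smul_zero]
  refine ⟨⟨h1, ?_⟩, ?_⟩
  · rw [funext h2]
    exact lp.memℓp _
  · ext j
    exact h2 j

end DirectSum

/-! ### Operators that are diagonal in an orthonormal basis -/

section Diagonal

variable {ι E : Type*} [NormedAddCommGroup E] [InnerProductSpace ℂ E]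

/-- The vectors `ξ` with `∑ |c k|² |⟨b k, ξ⟩|² < ∞`. -/
def diagDomain (b : HilbertBasis ι ℂ E) (c : ι → ℝ) : Submodule ℂ E where
  carrier := {ξ | Memℓp (fun k => (c k : ℂ) * b.repr ξ k) 2}
  zero_mem' := by
    have h : (fun k => (c k : ℂ) * b.repr (0 : E) k) = 0 := by ext k; simp
    change Memℓp (fun k => (c k : ℂ) * b.repr (0 : E) k) 2
    rw [h]
    exact zero_memℓp
  add_mem' := by
    intro x y hx hy
    have h : (fun k => (c k : ℂ) * b.repr (x + y) k)
        = (fun k => (c k : ℂ) * b.repr x k) + fun k => (c k : ℂ) * b.repr y k := by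
      ext k; simp [mul_add]
    change Memℓp (fun k => (c k : ℂ) * b.repr (x + y) k) 2
    rw [h]
    exact Memℓp.add hx hy
  smul_mem' := by
    intro a x hx
    have h : (fun k => (c k : ℂ) * b.repr (a • x) k)
        = a • fun k => (c k : ℂ) * b.repr x k := by
      ext k; simp [mul_left_comm]
    change Memℓp (fun k => (c k : ℂ) * b.repr (a • x) k) 2
    rw [h]
    exact Memℓp.const_smul hx a

/-- The unbounded operator that multiplies the basis vector `b k` by `c k`, on its maximal domain:
the vectors `ξ` with `∑ |c k|² |⟨b k, ξ⟩|² < ∞`. -/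
def diagPMap (b : HilbertBasis ι ℂ E) (c : ι → ℝ) : E →ₗ.[ℂ] E where
  domain := diagDomain b c
  toFun :=
    { toFun := fun ξ => b.repr.symm ⟨fun k => (c k : ℂ) * b.repr ξ.1 k, ξ.2⟩
      map_add' := fun x y => by
        apply b.repr.injective
        rw [map_add]
        simp only [LinearIsometryEquiv.apply_symm_apply]
        ext k
        change (c k : ℂ) * b.repr (x.1 + y.1) k
          = (c k : ℂ) * b.repr x.1 k + (c k : ℂ) * b.repr y.1 k
        rw [map_add, lp.coeFn_add, Pi.add_apply, mul_add]
      map_smul' := fun a x => by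
        apply b.repr.injective
        rw [map_smul]
        simp only [LinearIsometryEquiv.apply_symm_apply]
        ext k
        change (c k : ℂ) * b.repr (a • x.1) k = a * ((c k : ℂ) * b.repr x.1 k)
        rw [map_smul, lp.coeFn_smul, Pi.smul_apply, smul_eq_mul, mul_left_comm] }

lemma diagPMap_repr (b : HilbertBasis ι ℂ E) (c : ι → ℝ) (x : (diagPMap b c).domain) (k : ι) :
    b.repr (diagPMap b c x) k = (c k : ℂ) * b.repr (x : E) k := by
  change b.repr (b.repr.symm ⟨fun k => (c k : ℂ) * b.repr x.1 k, x.2⟩) k = _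
  rw [LinearIsometryEquiv.apply_symm_apply]

lemma diagPMap_basis (b : HilbertBasis ι ℂ E) (c : ι → ℝ) (k : ι) :
    ∃ h : b k ∈ (diagPMap b c).domain, diagPMap b c ⟨b k, h⟩ = (c k : ℂ) • b k := by
  classical
  have h1 : (fun j => (c j : ℂ) * b.repr (b k) j)
      = ((c k : ℂ) • lp.single 2 k (1 : ℂ) : lp (fun _ : ι => ℂ) 2) := by
    ext j
    rw [b.repr_self, lp.coeFn_smul, Pi.smul_apply, smul_eq_mul]
    by_cases hj : j = k
    · rw [hj]
    · have h0 : (lp.single 2 k (1 : ℂ) : lp (fun _ : ι => ℂ) 2) j = 0 := Pi.single_eq_of_ne hj _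
      exact (congrArg (fun z : ℂ => (c j : ℂ) * z) h0).trans
        ((mul_zero _).trans ((mul_zero _).symm.trans
          (congrArg (fun z : ℂ => (c k : ℂ) * z) h0).symm))
  have h2 : b k ∈ (diagPMap b c).domain := by
    change Memℓp (fun j => (c j : ℂ) * b.repr (b k) j) 2
    rw [h1]
    exact lp.memℓp _
  refine ⟨h2, b.repr.injective ?_⟩
  ext j
  rw [diagPMap_repr, map_smul, b.repr_self]
  exact (congrFun (b.repr_self k ▸ h1) j)

lemma norm_scalar_le {a : ι → ℝ} {C : ℝ} (ha : ∀ k, |a k| ≤ C) (k : ι) :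
    ‖(a k : ℂ) • ContinuousLinearMap.id ℂ ℂ‖ ≤ C := by
  rw [norm_smul, ContinuousLinearMap.norm_id, mul_one, Complex.norm_real, Real.norm_eq_abs]
  exact ha k

/-- The bounded operator that multiplies the basis vector `b k` by `a k`, for a bounded family. -/
def diagOp (b : HilbertBasis ι ℂ E) (a : ι → ℝ) {C : ℝ} (ha : ∀ k, |a k| ≤ C) : E →L[ℂ] E :=
  (b.repr.symm.toContinuousLinearEquiv : lp (fun _ : ι => ℂ) 2 →L[ℂ] E) ∘L
    blockDiag (G := fun _ : ι => ℂ) (fun k => (a k : ℂ) • ContinuousLinearMap.id ℂ ℂ)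
      (norm_scalar_le ha) ∘L
    (b.repr.toContinuousLinearEquiv : E →L[ℂ] lp (fun _ : ι => ℂ) 2)

lemma diagOp_repr (b : HilbertBasis ι ℂ E) (a : ι → ℝ) {C : ℝ} (ha : ∀ k, |a k| ≤ C)
    (x : E) (k : ι) : b.repr (diagOp b a ha x) k = (a k : ℂ) * b.repr x k := by
  change b.repr (b.repr.symm (blockDiag (G := fun _ : ι => ℂ)
    (fun k => (a k : ℂ) • ContinuousLinearMap.id ℂ ℂ) (norm_scalar_le ha) (b.repr x))) k = _
  rw [LinearIsometryEquiv.apply_symm_apply, blockDiag_apply]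
  simp

lemma norm_diagOp_le (b : HilbertBasis ι ℂ E) (a : ι → ℝ) {C : ℝ} (hC : 0 ≤ C)
    (ha : ∀ k, |a k| ≤ C) : ‖diagOp b a ha‖ ≤ C := by
  refine ContinuousLinearMap.opNorm_le_bound _ hC fun x => ?_
  have h := ContinuousLinearMap.le_of_opNorm_le _
    (norm_blockDiag_le (G := fun _ : ι => ℂ) _ hC (norm_scalar_le ha)) (b.repr x)
  rw [LinearIsometryEquiv.norm_map] at h
  refine le_trans (le_of_eq ?_) h
  exact LinearIsometryEquiv.norm_map b.repr.symm _

end Diagonal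

/-! ### Circles -/

/-- The circumference `2π · 2⁻ⁿ` of the circle of radius `2⁻ⁿ`. -/
def circ (n : ℕ) : ℝ := 2 * Real.pi * (2 ^ n)⁻¹

instance circ_pos (n : ℕ) : Fact (0 < circ n) := ⟨by unfold circ; positivity⟩

/-- The circle of radius `2⁻ⁿ`, parametrized by arclength: `ℝ` modulo `2π · 2⁻ⁿ`. -/
abbrev Circ (n : ℕ) : Type := AddCircle (circ n)

/-- `L²` of the circle of radius `2⁻ⁿ` for the normalized Lebesgue measure. -/
abbrev CircleL2 (n : ℕ) : Type := Lp ℂ 2 (AddCircle.haarAddCircle : Measure (Circ n))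

/-- Multiplication by a continuous function on `L²` of the circle. -/
def mulOp (n : ℕ) (g : C(Circ n, ℂ)) : CircleL2 n →L[ℂ] CircleL2 n :=
  (ContinuousLinearMap.mul ℂ ℂ).holderL AddCircle.haarAddCircle ∞ 2 2
    (ContinuousMap.toLp ∞ AddCircle.haarAddCircle ℂ g)

lemma mulOp_ae (n : ℕ) (g : C(Circ n, ℂ)) (ξ : CircleL2 n) :
    (mulOp n g ξ : Circ n → ℂ) =ᵐ[AddCircle.haarAddCircle] fun t => g t * ξ t := by
  filter_upwards [(ContinuousLinearMap.mul ℂ ℂ).coeFn_holder (r := 2)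
    (ContinuousMap.toLp ∞ AddCircle.haarAddCircle ℂ g) ξ,
    ContinuousMap.coeFn_toLp (p := ∞) (𝕜 := ℂ) AddCircle.haarAddCircle g] with t h1 h2
  refine h1.trans ?_
  rw [h2, ContinuousLinearMap.mul_apply']

lemma norm_mulOp_le (n : ℕ) (g : C(Circ n, ℂ)) : ‖mulOp n g‖ ≤ ‖g‖ := by
  have h1 : ‖ContinuousMap.toLp ∞ (AddCircle.haarAddCircle : Measure (Circ n)) ℂ g‖ ≤ ‖g‖ := by
    refine (ContinuousLinearMap.le_opNorm _ _).trans ?_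
    have := ContinuousMap.toLp_norm_le (p := ∞) (𝕜 := ℂ) (E := ℂ)
      (μ := (AddCircle.haarAddCircle : Measure (Circ n)))
    have h2 : ‖ContinuousMap.toLp (E := ℂ) ∞ (AddCircle.haarAddCircle : Measure (Circ n)) ℂ‖ ≤ 1 := by
      simpa using this
    simpa using mul_le_mul_of_nonneg_right h2 (norm_nonneg g)
  refine (ContinuousLinearMap.le_opNorm _ _).trans ?_
  have h3 : ‖(ContinuousLinearMap.mul ℂ ℂ).holderL
      (AddCircle.haarAddCircle : Measure (Circ n)) ∞ 2 2‖ ≤ 1 :=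
    (ContinuousLinearMap.norm_holderL_le _).trans (ContinuousLinearMap.opNorm_mul_le ℂ ℂ)
  calc _ ≤ 1 * ‖g‖ := mul_le_mul h3 h1 (norm_nonneg _) zero_le_one
    _ = ‖g‖ := one_mul _

/-- The eigenvalue `(2k + 1) / (2r)`, `r = 2⁻ⁿ`, of the translated Dirac operator
`-i d/dx + 1/(2r)` of the circle of radius `r` at the eigenvector `exp(i k x / r)`. -/
def circleEigenvalue (n : ℕ) (k : ℤ) : ℝ := (2 * k + 1) / (2 * (2 ^ n)⁻¹)

/-- The translated Dirac operator `D_r + 1/(2r)` of the circle of radius `r = 2⁻ⁿ`: the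
self-adjoint operator on `L²` that multiplies the Fourier basis vectors `exp(i k x / r)` by
`(2k + 1) / (2r)`, on its maximal domain. -/
def circleDirac (n : ℕ) : CircleL2 n →ₗ.[ℂ] CircleL2 n :=
  diagPMap fourierBasis (circleEigenvalue n)

lemma half_le_abs_circleEigenvalue (n : ℕ) (k : ℤ) : 1 / 2 ≤ |circleEigenvalue n k| := by
  have h1 : (1 : ℝ) ≤ |2 * (k : ℝ) + 1| := by
    have : (1 : ℤ) ≤ |2 * k + 1| := Int.one_le_abs (by omega)
    exact_mod_cast this
  have h2 : (1 : ℝ) ≤ 2 ^ n := one_le_pow₀ (by norm_num)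
  have h3 : circleEigenvalue n k = (2 * k + 1) * (2 ^ n / 2) := by
    unfold circleEigenvalue; field_simp
  rw [h3, abs_mul, abs_of_nonneg (by positivity : (0 : ℝ) ≤ 2 ^ n / 2)]
  nlinarith

lemma abs_eigenvalue_rpow_le {s : ℝ} (hs : 0 ≤ s) (n : ℕ) (k : ℤ) :
    |(|circleEigenvalue n k| ^ (-s))| ≤ 2 ^ s := by
  have h := half_le_abs_circleEigenvalue n k
  rw [abs_of_nonneg (Real.rpow_nonneg (abs_nonneg _) _)]
  calc |circleEigenvalue n k| ^ (-s) ≤ (1 / 2 : ℝ) ^ (-s) :=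
        Real.rpow_le_rpow_of_nonpos (by norm_num) h (by linarith)
    _ = 2 ^ s := by
      rw [one_div, Real.inv_rpow (by norm_num), Real.rpow_neg (by norm_num), inv_inv]

/-- `|D|^{-s}` for the Dirac operator `D` of the circle of radius `2⁻ⁿ` and `s ≥ 0`: the bounded
operator that multiplies each Fourier basis vector by `|λ|^{-s}`, `λ` its eigenvalue for `D`. -/
def circleAbsPow (n : ℕ) {s : ℝ} (hs : 0 ≤ s) : CircleL2 n →L[ℂ] CircleL2 n :=
  diagOp fourierBasis (fun k => |circleEigenvalue n k| ^ (-s)) (abs_eigenvalue_rpow_le hs n)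

/-! ### The Sierpinski gasket -/

/-- The Euclidean plane. -/
abbrev Plane : Type := EuclideanSpace ℝ (Fin 2)

/-- The vertices (lower left, lower right, top) of the equilateral triangle of side `2π/3`. -/
def vertex : Fin 3 → Plane :=
  ![!₂[0, 0], !₂[2 * Real.pi / 3, 0], !₂[Real.pi / 3, Real.pi / Real.sqrt 3]]

/-- The contraction by the factor `1/2` towards the vertex with index `j`. -/
def contraction (j : Fin 3) (x : Plane) : Plane := (1 / 2 : ℝ) • (x + vertex j)

/-- The composition of contractions indexed by a word of length `n`. -/
def wordMap : (n : ℕ) → (Fin n → Fin 3) → Plane → Plane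
  | 0, _, x => x
  | n + 1, w, x => contraction (w 0) (wordMap n (Fin.tail w) x)

/-- The position, on the circle of radius `2⁻ⁿ`, of the three vertices: the lower right vertex is
the starting point, then follow counterclockwise the top and the lower left vertex. -/
def vertexPos (n : ℕ) : Fin 3 → Circ n :=
  ![((2 * circ n / 3 : ℝ) : Circ n), 0, ((circ n / 3 : ℝ) : Circ n)]

/-- The barycentric coordinate with index `j` of the point with arclength parameter `t` on the
boundary of a triangle: the hat function that is `1` at vertex `j`, affine on the two adjacent
edges, and `0` on the opposite edge. -/
def baryCoord (n : ℕ) (j : Fin 3) (t : Circ n) : ℝ :=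
  max 0 (1 - 3 * ‖t - vertexPos n j‖ / circ n)

/-- For a word `w` of length `n`, the parametrization by arclength, counterclockwise and from its
lower right corner, of the boundary `Δ_w` of the triangle of side `2⁻ⁿ · 2π/3` with address `w`,
by the circle of radius `2⁻ⁿ`. -/
def triangleParam (n : ℕ) (w : Fin n → Fin 3) (t : Circ n) : Plane :=
  wordMap n w (∑ j, baryCoord n j t • vertex j)

/-- The Sierpinski gasket: the closure of the union over all `n` of the graphs `SG_n`, where `SG_n`
is the union of the `3ⁿ` triangles `Δ_w`, `w` a word of length `n`. -/
def gasket : Set Plane :=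
  closure (⋃ (n : ℕ) (w : Fin n → Fin 3), Set.range (triangleParam n w))

lemma continuous_wordMap : ∀ (n : ℕ) (w : Fin n → Fin 3), Continuous (wordMap n w)
  | 0, _ => continuous_id
  | n + 1, w => by
    have := continuous_wordMap n (Fin.tail w)
    exact (this.add continuous_const).const_smul (1 / 2 : ℝ)

lemma continuous_triangleParam (n : ℕ) (w : Fin n → Fin 3) : Continuous (triangleParam n w) := by
  unfold triangleParam baryCoord
  exact (continuous_wordMap n w).comp (by fun_prop)

lemma norm_wordMap_le {R : ℝ} (hR : ∀ j, ‖vertex j‖ ≤ R) :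
    ∀ (n : ℕ) (w : Fin n → Fin 3) (x : Plane), ‖x‖ ≤ R → ‖wordMap n w x‖ ≤ R
  | 0, _, _, hx => hx
  | n + 1, w, x, hx => by
    have h1 := norm_wordMap_le hR n (Fin.tail w) x hx
    have h2 := norm_add_le (wordMap n (Fin.tail w) x) (vertex (w 0))
    have h3 := hR (w 0)
    simp only [wordMap, contraction, norm_smul]
    rw [Real.norm_of_nonneg (by norm_num)]
    linarith

lemma baryCoord_near (n : ℕ) (j : Fin 3) {x p : ℝ} (v : ℝ) (m : ℤ)
    (hj : vertexPos n j = (p : Circ n)) (hx : x = p + circ n / 3 * v + m * circ n)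
    (hv : |v| ≤ 3 / 2) : baryCoord n j (x : Circ n) = max 0 (1 - |v|) := by
  have hp := (circ_pos n).out
  have h : (x : Circ n) - (p : Circ n) = ((circ n / 3 * v : ℝ) : Circ n) := by
    have h0 : ((m * circ n : ℝ) : Circ n) = 0 := by
      rw [AddCircle.coe_eq_zero_iff]
      exact ⟨m, by simp⟩
    rw [hx, AddCircle.coe_add, AddCircle.coe_add, h0, add_zero, add_sub_cancel_left]
  have hn : |circ n / 3 * v| = circ n / 3 * |v| := by
    rw [abs_mul, abs_of_pos (by positivity : 0 < circ n / 3)]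
  have h2 : ‖((circ n / 3 * v : ℝ) : Circ n)‖ = circ n / 3 * |v| := by
    rw [← hn, AddCircle.norm_coe_eq_abs_iff _ hp.ne', abs_of_pos hp, hn]
    nlinarith
  rw [baryCoord, hj, h, h2]
  congr 2
  field_simp

lemma baryCoord_far (n : ℕ) (j : Fin 3) {x p : ℝ} (v : ℝ) (m : ℤ)
    (hj : vertexPos n j = (p : Circ n)) (hx : x = p + circ n / 3 * v + m * circ n)
    (hv1 : 1 ≤ v) (hv2 : v ≤ 2) : baryCoord n j (x : Circ n) = 0 := by
  rcases le_total v (3 / 2) with h | h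
  · rw [baryCoord_near n j v m hj hx (by rw [abs_of_nonneg] <;> linarith),
      abs_of_nonneg (by linarith)]
    exact max_eq_left (by linarith)
  · rw [baryCoord_near n j (v - 3) (m + 1) hj (by rw [hx]; push_cast; ring)
      (by rw [abs_of_nonpos] <;> linarith), abs_of_nonpos (by linarith)]
    exact max_eq_left (by linarith)

lemma baryCoord_edge (n : ℕ) (i j k : Fin 3) {p q r x : ℝ} (m₁ m₂ m₃ : ℤ) (u : ℝ) (h0 : 0 ≤ u)
    (h1 : u ≤ 1) (hi : vertexPos n i = (p : Circ n)) (hj : vertexPos n j = (q : Circ n))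
    (hk : vertexPos n k = (r : Circ n)) (hip : x = p + circ n / 3 * u + m₁ * circ n)
    (hjq : x = q + circ n / 3 * (u - 1) + m₂ * circ n)
    (hkr : x = r + circ n / 3 * (u + 1) + m₃ * circ n) :
    baryCoord n i (x : Circ n) = 1 - u ∧ baryCoord n j (x : Circ n) = u ∧
      baryCoord n k (x : Circ n) = 0 := by
  refine ⟨?_, ?_, baryCoord_far n k (u + 1) m₃ hk hkr (by linarith) (by linarith)⟩
  · rw [baryCoord_near n i u m₁ hi hip (by rw [abs_of_nonneg] <;> linarith),
      abs_of_nonneg h0, max_eq_right (by linarith)]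
  · rw [baryCoord_near n j (u - 1) m₂ hj hjq (by rw [abs_of_nonpos] <;> linarith),
      abs_of_nonpos (by linarith), max_eq_right (by linarith)]
    ring

/-- On the three thirds of the circle, `triangleParam` runs at constant speed along the edges:
lower right to top, top to lower left, lower left to lower right. -/
lemma triangleParam_edges (n : ℕ) (w : Fin n → Fin 3) (u : ℝ) (h0 : 0 ≤ u) (h1 : u ≤ 1) :
    triangleParam n w ((circ n / 3 * u : ℝ) : Circ n)
        = wordMap n w ((1 - u) • vertex 1 + u • vertex 2) ∧
    triangleParam n w ((circ n / 3 * (1 + u) : ℝ) : Circ n)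
        = wordMap n w ((1 - u) • vertex 2 + u • vertex 0) ∧
    triangleParam n w ((circ n / 3 * (2 + u) : ℝ) : Circ n)
        = wordMap n w ((1 - u) • vertex 0 + u • vertex 1) := by
  have hT := (circ_pos n).out
  have p0 : vertexPos n 0 = ((2 * circ n / 3 : ℝ) : Circ n) := rfl
  have p1 : vertexPos n 1 = ((0 : ℝ) : Circ n) := rfl
  have p2 : vertexPos n 2 = ((circ n / 3 : ℝ) : Circ n) := rfl
  refine ⟨?_, ?_, ?_⟩
  · obtain ⟨a, b, c⟩ := baryCoord_edge n 1 2 0 (x := circ n / 3 * u) 0 0 (-1) u h0 h1 p1 p2 p0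
      (by push_cast; ring) (by push_cast; ring) (by push_cast; ring)
    rw [triangleParam, Fin.sum_univ_three, a, b, c, zero_smul, zero_add]
  · obtain ⟨a, b, c⟩ := baryCoord_edge n 2 0 1 (x := circ n / 3 * (1 + u)) 0 0 0 u h0 h1 p2 p0 p1
      (by push_cast; ring) (by push_cast; ring) (by push_cast; ring)
    rw [triangleParam, Fin.sum_univ_three, a, b, c, zero_smul, add_zero, add_comm]
  · obtain ⟨a, b, c⟩ := baryCoord_edge n 0 1 2 (x := circ n / 3 * (2 + u)) 0 1 0 u h0 h1 p0 p1 p2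
      (by push_cast; ring) (by push_cast; ring) (by push_cast; ring)
    rw [triangleParam, Fin.sum_univ_three, a, b, c, zero_smul, add_zero]

lemma baryCoord_mem (n : ℕ) (j : Fin 3) (t : Circ n) : |baryCoord n j t| ≤ 1 := by
  have h : 0 ≤ 3 * ‖t - vertexPos n j‖ / circ n := by
    have := (circ_pos n).out
    positivity
  rw [abs_of_nonneg (le_max_left _ _)]
  exact max_le zero_le_one (by linarith)

instance : CompactSpace gasket := by
  obtain ⟨R, hR⟩ : ∃ R, R = ∑ j, ‖vertex j‖ := ⟨_, rfl⟩
  have hv : ∀ j, ‖vertex j‖ ≤ R := fun j => hR ▸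
    Finset.single_le_sum (f := fun j => ‖vertex j‖) (fun _ _ => norm_nonneg _) (Finset.mem_univ j)
  refine isCompact_iff_compactSpace.mp ?_
  refine Metric.isCompact_of_isClosed_isBounded isClosed_closure
    (Bornology.IsBounded.closure (isBounded_iff_forall_norm_le.mpr ⟨R, ?_⟩))
  intro x hx
  obtain ⟨n, w, t, rfl⟩ := Set.mem_iUnion₂.mp hx
  refine norm_wordMap_le hv n w _ ((norm_sum_le _ _).trans (hR ▸ Finset.sum_le_sum fun j _ => ?_))
  rw [norm_smul, Real.norm_eq_abs]
  exact mul_le_of_le_one_left (norm_nonneg _) (baryCoord_mem n j t)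

/-- The parametrization of `Δ_w` as a continuous map from the circle to the gasket. -/
def gasketPath (n : ℕ) (w : Fin n → Fin 3) : C(Circ n, gasket) where
  toFun t := ⟨triangleParam n w t,
    subset_closure (Set.mem_iUnion₂.mpr ⟨n, w, Set.mem_range_self t⟩)⟩
  continuous_toFun := (continuous_triangleParam n w).subtype_mk _

/-! ### The spectral triple of the gasket -/

/-- The index set of all triangles: words of any length `n`. -/
abbrev Word : Type := Σ n : ℕ, (Fin n → Fin 3)

/-- The Hilbert space `H_SG`: the Hilbert sum over all triangles of `L²` of the circle of radius
`2⁻ⁿ`, with `n` the level of the triangle. -/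
abbrev GasketL2 : Type := lp (fun w : Word => CircleL2 w.1) 2

/-- The Dirac operator `D_SG`, the direct sum of the translated circle operators. -/
def gasketDirac : GasketL2 →ₗ.[ℂ] GasketL2 :=
  directSumPMap (fun w : Word => circleDirac w.1)

lemma norm_mulOp_path_le (f : C(gasket, ℂ)) (w : Word) :
    ‖mulOp w.1 (f.comp (gasketPath w.1 w.2))‖ ≤ ‖f‖ :=
  (norm_mulOp_le _ _).trans
    ((ContinuousMap.norm_le _ (norm_nonneg _)).mpr fun _ => f.norm_coe_le_norm _)

/-- The representation `π_SG` of `C(SG)`: on the summand of the triangle `Δ_w`, `f` acts as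
multiplication by `f ∘ r_w`, where `r_w` is the parametrization of `Δ_w`. -/
def gasketRep (f : C(gasket, ℂ)) : GasketL2 →L[ℂ] GasketL2 :=
  blockDiag (fun w : Word => mulOp w.1 (f.comp (gasketPath w.1 w.2))) (norm_mulOp_path_le f)

/-- The bounded operator `|D_SG|^{-s}`, for `s ≥ 0`: the direct sum of the operators `|D|^{-s}` of
the circles. See `gasketAbsPow_eigen` and `gasketAbsPow_unique`. -/
def gasketAbsPow {s : ℝ} (hs : 0 ≤ s) : GasketL2 →L[ℂ] GasketL2 :=
  blockDiag (fun w : Word => circleAbsPow w.1 hs) (fun w => norm_diagOp_le _ _ (by positivity) (abs_eigenvalue_rpow_le hs w.1))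

/-- `|D_SG|^{-s}` multiplies each eigenvector of `D_SG` by `|λ|^{-s}`, `λ` being its eigenvalue. -/
lemma gasketAbsPow_eigen {s : ℝ} (hs : 0 ≤ s) (lam : ℝ) (x : gasketDirac.domain)
    (hx : gasketDirac x = (lam : ℂ) • (x : GasketL2)) :
    gasketAbsPow hs x = ((|lam| ^ (-s) : ℝ) : ℂ) • (x : GasketL2) := by
  ext w : 2
  apply (fourierBasis (T := circ w.1)).repr.injective
  ext k
  have h1 : circleDirac w.1 ⟨(x : GasketL2) w, x.2.1 w⟩ = (lam : ℂ) • (x : GasketL2) w :=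
    congrArg (fun y : GasketL2 => y w) hx
  have h2 := diagPMap_repr fourierBasis (circleEigenvalue w.1) ⟨(x : GasketL2) w, x.2.1 w⟩ k
  have h3 : (fourierBasis (T := circ w.1)).repr (gasketAbsPow hs x w) k = _ :=
    diagOp_repr fourierBasis _ (abs_eigenvalue_rpow_le hs w.1) ((x : GasketL2) w) k
  have h4 : (lam : ℂ) * (fourierBasis (T := circ w.1)).repr ((x : GasketL2) w) k
      = (circleEigenvalue w.1 k : ℂ) * (fourierBasis (T := circ w.1)).repr ((x : GasketL2) w) k := by
    rw [← h2]
    change _ = (fourierBasis (T := circ w.1)).repr (circleDirac w.1 ⟨(x : GasketL2) w, _⟩) k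
    rw [h1, map_smul]
    rfl
  rw [h3]
  change _ = (fourierBasis (T := circ w.1)).repr
    (((|lam| ^ (-s) : ℝ) : ℂ) • ((x : GasketL2) w)) k
  rw [map_smul, lp.coeFn_smul, Pi.smul_apply, smul_eq_mul]
  rcases mul_eq_mul_right_iff.mp h4 with h | h
  · rw [Complex.ofReal_inj.mp h]
  · rw [h, mul_zero, mul_zero]

/-- The Fourier basis vectors of each summand are eigenvectors of `D_SG`. -/
lemma gasketEigenvector (w : Word) (k : ℤ) :
    ∃ h : lp.single (E := fun w : Word => CircleL2 w.1) 2 w (fourierBasis (T := circ w.1) k)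
        ∈ gasketDirac.domain,
      gasketDirac ⟨_, h⟩ = (circleEigenvalue w.1 k : ℂ) •
        lp.single (E := fun w : Word => CircleL2 w.1) 2 w (fourierBasis (T := circ w.1) k) := by
  obtain ⟨h, hk⟩ := diagPMap_basis (fourierBasis (T := circ w.1)) (circleEigenvalue w.1) k
  exact directSumPMap_single (fun w : Word => circleDirac w.1) w _ _ h hk

/-- The property of `gasketAbsPow_eigen` determines `|D_SG|^{-s}`. -/
lemma gasketAbsPow_unique {s : ℝ} (hs : 0 ≤ s) (A : GasketL2 →L[ℂ] GasketL2)
    (hA : ∀ (lam : ℝ) (x : gasketDirac.domain), gasketDirac x = (lam : ℂ) • (x : GasketL2) →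
      A x = ((|lam| ^ (-s) : ℝ) : ℂ) • (x : GasketL2)) :
    A = gasketAbsPow hs := by
  refine lp.ext_continuousLinearMap (by simp) fun w => ?_
  refine ContinuousLinearMap.ext_on
    (Submodule.dense_iff_topologicalClosure_eq_top.mpr
      (fourierBasis (T := circ w.1)).dense_span) ?_
  rintro _ ⟨k, rfl⟩
  have hcol := gasketEigenvector w k
  obtain ⟨h, hk⟩ := hcol
  exact (hA _ ⟨_, h⟩ hk).trans (gasketAbsPow_eigen hs _ ⟨_, h⟩ hk).symm

/-- The dimension `log 3 / log 2` of the gasket. -/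
def gasketDim : ℝ := Real.log 3 / Real.log 2

lemma gasketDim_nonneg : 0 ≤ gasketDim :=
  div_nonneg (Real.log_nonneg (by norm_num)) (Real.log_nonneg (by norm_num))

/-- The operator `π_SG(f) |D_SG|^{-log 3 / log 2}`. -/
def gasketOp (f : C(gasket, ℂ)) : GasketL2 →L[ℂ] GasketL2 :=
  gasketRep f ∘L gasketAbsPow gasketDim_nonneg

/-- The functional `τ(f) = Tr_ω (π_SG(f) |D_SG|^{-log 3 / log 2})` on `C(SG)`. -/
def tau (ω : DixmierLimit) (f : C(gasket, ℂ)) : ℂ := dixmierTrace ω (gasketOp f)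

/-- The normalized Hausdorff measure of dimension `log 3 / log 2` of the gasket. -/
def hausdorffProb : Measure gasket :=
  ((Measure.hausdorffMeasure gasketDim : Measure gasket) Set.univ)⁻¹ •
    (Measure.hausdorffMeasure gasketDim : Measure gasket)

/-- The state `ψ(f) = ∫ f dμ` on `C(SG)`. -/
def psi (f : C(gasket, ℂ)) : ℂ := ∫ x, f x ∂hausdorffProb

end SG

end

/-! Write d = log 3 / log 2. Since 2^d = 3, the eigenvalues of |D|^{-d} on a triangle of level l are
3^{-l} · 3|2k+1|^{-d}. There are 3^l triangles of level l, so every level carries the same total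
weight Σ_k 3|2k+1|^{-d} = 4ζ(d) (`hasSum_odd_rpow`). Only levels up to log_3 N + O(1) matter for the
first N singular values, whence the growth 4ζ(d) log N / log 3. A function f weights level l by its
mean over the triangles of that level, and these means tend to ∫ f dμ.

The operator T = π(f)|D|^{-d} need not be self-adjoint, so the core result
(`tendsto_partialTrace_div_log`) concerns the positive part of Re T. Its partial traces divided by
log N converge to 4ζ(d)/log 3 · ∫ (Re f)⁺ dμ. Applied to cf for c = 1, -1, -i, i, this gives the
four pieces in the definition of the Dixmier trace; each is an honest limit, so the choice of ω
plays no role.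

The trace of (Re T)⁺ is controlled by the quadratic form of T alone. It is at most Σ Re⟨e_i, T e_i⟩
for some orthonormal family of at most N eigenvectors, and by Ky Fan's inequality at least this sum
for every such family. `gasketOp_eq` splits T into a part diagonal in the Fourier basis (f replaced
by its value at a corner of each triangle) and a contraction times a diagonal operator weighted by
the oscillation of f. Diagonal operators are bounded by Σ (λ_k - 1/N)⁺ + 1, and the oscillations
tend to 0 by uniform continuity. For the lower bound, Fourier vectors of finitely many levels and
frequencies are test vectors.

Finiteness of the Hausdorff measure follows from the covers by 3^n cells, positivity from the mass
distribution principle for the uniform Bernoulli measure on addresses. Each n-cell has mass at most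
3^{-n} by scaling; as the cells cover the gasket, equality holds and overlaps are null. -/

noncomputable section

namespace SG

/-! ### Singular values as approximation numbers -/

section SingularValues

variable {H : Type*} [NormedAddCommGroup H] [InnerProductSpace ℂ H]

open InnerProductSpace ContinuousLinearMap

lemma singularValue_nonneg (T : H →L[ℂ] H) (n : ℕ) : 0 ≤ singularValue T n :=
  Real.sInf_nonneg (by rintro _ ⟨R, -, rfl⟩; exact norm_nonneg _)

lemma singularValue_le_norm_sub (T R : H →L[ℂ] H) {n : ℕ}
    (hR : LinearMap.rank (R : H →ₗ[ℂ] H) ≤ (n : Cardinal)) : singularValue T n ≤ ‖T - R‖ :=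
  csInf_le ⟨0, by rintro _ ⟨R, -, rfl⟩; exact norm_nonneg _⟩ ⟨R, hR, rfl⟩

lemma le_singularValue {T : H →L[ℂ] H} {n : ℕ} {c : ℝ}
    (h : ∀ R : H →L[ℂ] H, LinearMap.rank (R : H →ₗ[ℂ] H) ≤ (n : Cardinal) → c ≤ ‖T - R‖) :
    c ≤ singularValue T n := by
  refine le_csInf ⟨_, 0, ?_, rfl⟩ (by rintro _ ⟨R, hR, rfl⟩; exact h R hR)
  rw [ContinuousLinearMap.toLinearMap_zero, LinearMap.rank_zero]
  exact zero_le

lemma singularValue_le_norm (T : H →L[ℂ] H) (n : ℕ) : singularValue T n ≤ ‖T‖ := by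
  have h := singularValue_le_norm_sub T 0 (n := n) (by
    rw [ContinuousLinearMap.toLinearMap_zero, LinearMap.rank_zero]; exact zero_le)
  rwa [sub_zero] at h

lemma partialTrace_mono (T : H →L[ℂ] H) : Monotone (partialTrace T) := fun _ _ h =>
  Finset.sum_le_sum_of_subset_of_nonneg (Finset.range_subset_range.mpr h)
    fun _ _ _ => singularValue_nonneg T _

/-- If `R` competes for `T`, then `B ∘L R` has no larger rank and competes for `B ∘L T`. -/
lemma singularValue_comp_le (B T : H →L[ℂ] H) {C : ℝ} (hB : ‖B‖ ≤ C) (n : ℕ) :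
    singularValue (B ∘L T) n ≤ C * singularValue T n := by
  have hC : 0 ≤ C := (norm_nonneg B).trans hB
  rcases hC.eq_or_lt with h0 | h0
  · subst h0
    rw [norm_le_zero_iff.mp hB, ContinuousLinearMap.zero_comp, zero_mul]
    simpa using singularValue_le_norm (0 : H →L[ℂ] H) n
  rw [← div_le_iff₀' h0]
  refine le_singularValue fun R hR => ?_
  rw [div_le_iff₀' h0]
  have h1 : LinearMap.rank ((B ∘L R : H →L[ℂ] H) : H →ₗ[ℂ] H) ≤ (n : Cardinal) := by
    rw [ContinuousLinearMap.toLinearMap_comp]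
    exact (LinearMap.rank_comp_le_right _ _).trans hR
  calc singularValue (B ∘L T) n ≤ ‖B ∘L T - B ∘L R‖ := singularValue_le_norm_sub _ _ h1
    _ = ‖B ∘L (T - R)‖ := by rw [ContinuousLinearMap.comp_sub]
    _ ≤ ‖B‖ * ‖T - R‖ := ContinuousLinearMap.opNorm_comp_le _ _
    _ ≤ C * ‖T - R‖ := by gcongr

lemma partialTrace_comp_le (B T : H →L[ℂ] H) {C : ℝ} (hB : ‖B‖ ≤ C) (N : ℕ) :
    partialTrace (B ∘L T) N ≤ C * partialTrace T N := by
  unfold partialTrace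
  rw [Finset.mul_sum]
  exact Finset.sum_le_sum fun j _ => singularValue_comp_le B T hB j

lemma rank_rankOne_le_one (x y : H) :
    LinearMap.rank (rankOne ℂ x y : H →ₗ[ℂ] H) ≤ 1 := by
  by_cases hx : x = 0
  · subst hx; simp [LinearMap.rank_zero]
  by_cases hy : y = 0
  · subst hy; simp [LinearMap.rank_zero]
  · exact (rank_rankOne hx hy).le

/-- Adding the rank-one term to a competitor for `T` leaves the error unchanged and costs one rank.
This is the step that splits off the top eigenvector of a positive operator. -/
lemma singularValue_succ_le_add_rankOne (T : H →L[ℂ] H) (x y : H) (n : ℕ) :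
    singularValue (T + rankOne ℂ x y) (n + 1) ≤ singularValue T n := by
  refine le_singularValue fun R hR => ?_
  have h : LinearMap.rank ((R + rankOne ℂ x y : H →L[ℂ] H) : H →ₗ[ℂ] H)
      ≤ ((n + 1 : ℕ) : Cardinal) := by
    rw [ContinuousLinearMap.toLinearMap_add, Nat.cast_add, Nat.cast_one]
    exact (LinearMap.rank_add_le _ _).trans (add_le_add hR (rank_rankOne_le_one x y))
  refine (singularValue_le_norm_sub _ _ h).trans_eq ?_
  rw [add_sub_add_right_eq_sub]

/-- Dimension count behind the min-max principle: rank at most n cannot be injective on n + 1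
dimensions. -/
lemma exists_ne_zero_of_rank_lt (R : H →L[ℂ] H) {n : ℕ}
    (hR : LinearMap.rank (R : H →ₗ[ℂ] H) ≤ (n : Cardinal))
    (f : (Fin (n + 1) → ℂ) →ₗ[ℂ] H) : ∃ c, c ≠ 0 ∧ R (f c) = 0 := by
  by_contra! h
  have hinj : Function.Injective ((R : H →ₗ[ℂ] H) ∘ₗ f) := by
    rw [← LinearMap.ker_eq_bot, LinearMap.ker_eq_bot']
    intro c hc
    by_contra h0
    exact h c h0 hc
  -- Cardinal lifts appear because `H` may live in another universe than the coordinate space.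
  have h1 := LinearMap.lift_rank_le_of_injective _
    ((LinearEquiv.ofInjective _ hinj).injective.comp (fun _ _ h => h) :
      Function.Injective (LinearEquiv.ofInjective _ hinj).toLinearMap)
  have h2 : LinearMap.rank ((R : H →ₗ[ℂ] H) ∘ₗ f) ≤ n := by
    refine le_trans ?_ hR
    exact LinearMap.rank_comp_le_left _ _
  have h3 : Module.rank ℂ (LinearMap.range ((R : H →ₗ[ℂ] H) ∘ₗ f)) ≤ n := h2
  rw [rank_fin_fun, Cardinal.lift_natCast] at h1
  have h4 := h1.trans (Cardinal.lift_le.mpr h3)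
  rw [Cardinal.lift_natCast, Nat.cast_le] at h4
  omega

/-- The isometric embedding of a Euclidean space determined by a finite orthonormal family. -/
def orthonormalEmbedding {M : ℕ} (e : Fin M → H) : EuclideanSpace ℂ (Fin M) →L[ℂ] H :=
  LinearMap.toContinuousLinearMap
    (Fintype.linearCombination ℂ e ∘ₗ (WithLp.linearEquiv 2 ℂ (Fin M → ℂ)).toLinearMap)

lemma orthonormalEmbedding_apply {M : ℕ} (e : Fin M → H) (x : EuclideanSpace ℂ (Fin M)) :
    orthonormalEmbedding e x = ∑ i, x i • e i := rfl

lemma orthonormalEmbedding_basisFun {M : ℕ} (e : Fin M → H) (i : Fin M) :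
    orthonormalEmbedding e (EuclideanSpace.basisFun (Fin M) ℂ i) = e i := by
  rw [orthonormalEmbedding_apply, Finset.sum_eq_single i] <;> simp +contextual

lemma norm_orthonormalEmbedding {M : ℕ} {e : Fin M → H} (he : Orthonormal ℂ e)
    (x : EuclideanSpace ℂ (Fin M)) : ‖orthonormalEmbedding e x‖ = ‖x‖ := by
  have h : (inner ℂ (orthonormalEmbedding e x) (orthonormalEmbedding e x) : ℂ) = inner ℂ x x := by
    rw [orthonormalEmbedding_apply, he.inner_sum, PiLp.inner_apply]
    exact Finset.sum_congr rfl fun i _ => mul_comm _ _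
  rw [inner_self_eq_norm_sq_to_K, inner_self_eq_norm_sq_to_K] at h
  have h2 : ‖orthonormalEmbedding e x‖ ^ 2 = ‖x‖ ^ 2 := by exact_mod_cast h
  exact (sq_eq_sq₀ (norm_nonneg _) (norm_nonneg _)).mp h2

end SingularValues

/-! ### Ky Fan's inequality -/

section KyFan

variable {H : Type*} [NormedAddCommGroup H] [InnerProductSpace ℂ H] [CompleteSpace H]

open InnerProductSpace ContinuousLinearMap

/-- Ky Fan's inequality. -/
theorem norm_sum_inner_le_partialTrace (T : H →L[ℂ] H) {M : ℕ} {e : Fin M → H}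
    (he : Orthonormal ℂ e) : ‖∑ i, inner ℂ (e i) (T (e i))‖ ≤ partialTrace T M := by
  set J := orthonormalEmbedding e with hJ
  have hJn : ∀ x, ‖J x‖ = ‖x‖ := norm_orthonormalEmbedding he
  let L : EuclideanSpace ℂ (Fin M) →L[ℂ] H := T ∘L J
  -- The eigenvectors `u j` of L*L are the right singular vectors of `T` restricted to the span of
  -- `e`. In that basis the trace of the compression is bounded term by term by ‖L (u j)‖.
  let Q : EuclideanSpace ℂ (Fin M) →L[ℂ] EuclideanSpace ℂ (Fin M) := adjoint L ∘L L
  have hQ : (Q : EuclideanSpace ℂ (Fin M) →ₗ[ℂ] _).IsSymmetric :=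
    (isPositive_adjoint_comp_self L).isSymmetric
  have hfr : Module.finrank ℂ (EuclideanSpace ℂ (Fin M)) = M := by simp
  let u := hQ.eigenvectorBasis hfr
  let lam := hQ.eigenvalues hfr
  have hlam : Antitone lam := hQ.eigenvalues_antitone hfr
  have hQu : ∀ i, Q (u i) = (lam i : ℂ) • u i := hQ.apply_eigenvectorBasis hfr
  have hQin : ∀ x y, (inner ℂ x (Q y) : ℂ) = inner ℂ (L x) (L y) := fun x y => by
    rw [ContinuousLinearMap.comp_apply, adjoint_inner_right]
  have hLu : ∀ i, ‖L (u i)‖ ^ 2 = lam i := fun i => by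
    have h := hQin (u i) (u i)
    rw [hQu, inner_smul_right, inner_self_eq_norm_sq_to_K, inner_self_eq_norm_sq_to_K,
      u.orthonormal.1 i] at h
    simp only [RCLike.ofReal_one, one_pow, mul_one] at h
    exact Complex.ofReal_injective (by push_cast; exact h.symm)
  -- min-max bound
  have key : ∀ j : Fin M, ‖L (u j)‖ ≤ singularValue T j := by
    intro j
    refine le_singularValue fun R hR => ?_
    let inc : Fin (j + 1) → Fin M := Fin.castLE j.2
    let f : (Fin ((j : ℕ) + 1) → ℂ) →ₗ[ℂ] H :=
      (J : _ →ₗ[ℂ] H) ∘ₗ Fintype.linearCombination ℂ (fun i => u (inc i))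
    obtain ⟨c, hc0, hc⟩ := exists_ne_zero_of_rank_lt R hR f
    set x : EuclideanSpace ℂ (Fin M) := ∑ i, c i • u (inc i) with hx
    have hfx : f c = J x := rfl
    have hon : Orthonormal ℂ (fun i => u (inc i)) :=
      u.orthonormal.comp inc (Fin.castLE_injective _)
    have hxx : (inner ℂ x x : ℂ) = ∑ i, (starRingEnd ℂ) (c i) * c i := hon.inner_sum c c Finset.univ
    have hxn : ‖x‖ ^ 2 = ∑ i, ‖c i‖ ^ 2 := by
      rw [inner_self_eq_norm_sq_to_K] at hxx
      have : ((‖x‖ ^ 2 : ℝ) : ℂ) = ((∑ i, ‖c i‖ ^ 2 : ℝ) : ℂ) := by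
        push_cast
        refine hxx.trans (Finset.sum_congr rfl fun i _ => ?_)
        rw [mul_comm, Complex.mul_conj, Complex.normSq_eq_norm_sq]; push_cast; rfl
      exact_mod_cast this
    have hQx : Q x = ∑ i, ((lam (inc i) : ℂ) * c i) • u (inc i) := by
      rw [hx, map_sum]
      refine Finset.sum_congr rfl fun i _ => ?_
      rw [map_smul, hQu, smul_smul, mul_comm]
    have hLx : ‖L x‖ ^ 2 = ∑ i, lam (inc i) * ‖c i‖ ^ 2 := by
      have h := hQin x x
      have h' : (inner ℂ x (Q x) : ℂ) = ∑ i, (starRingEnd ℂ) (c i) * ((lam (inc i) : ℂ) * c i) := by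
        rw [hQx]; exact hon.inner_sum c _ Finset.univ
      rw [h', inner_self_eq_norm_sq_to_K] at h
      have : ((‖L x‖ ^ 2 : ℝ) : ℂ) = ((∑ i, lam (inc i) * ‖c i‖ ^ 2 : ℝ) : ℂ) := by
        push_cast
        refine h.symm.trans (Finset.sum_congr rfl fun i _ => ?_)
        rw [mul_left_comm, mul_comm (starRingEnd ℂ (c i)), Complex.mul_conj,
          Complex.normSq_eq_norm_sq]
        push_cast; rfl
      exact_mod_cast this
    -- `x` lies in the span of the top j + 1 eigenvectors, whose eigenvalues are all at least `lam
    -- j`.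
    have hle : lam j * ‖x‖ ^ 2 ≤ ‖L x‖ ^ 2 := by
      rw [hxn, hLx, Finset.mul_sum]
      refine Finset.sum_le_sum fun i _ => mul_le_mul_of_nonneg_right (hlam ?_) (sq_nonneg _)
      rw [Fin.le_def]
      exact Nat.lt_succ_iff.mp i.2
    have hxpos : 0 < ‖x‖ := by
      rw [norm_pos_iff]
      intro h0
      apply hc0
      rw [h0, norm_zero] at hxn
      have := (Finset.sum_eq_zero_iff_of_nonneg (fun i _ => sq_nonneg ‖c i‖)).mp
        (hxn.symm.trans (by norm_num))
      ext i
      simpa using this i (Finset.mem_univ i)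
    have hub : ‖L x‖ ≤ ‖T - R‖ * ‖x‖ := by
      have : L x = (T - R) (J x) := by
        rw [_root_.sub_apply, ← hfx, hc, sub_zero]; rfl
      rw [this, ← hJn x]
      exact le_opNorm _ _
    have h3 : (‖L (u j)‖ * ‖x‖) ^ 2 ≤ (‖T - R‖ * ‖x‖) ^ 2 := by
      rw [mul_pow, hLu]
      exact hle.trans (pow_le_pow_left₀ (norm_nonneg _) hub 2)
    have h4 := (sq_le_sq₀ (by positivity) (by positivity)).mp h3
    exact le_of_mul_le_mul_right h4 hxpos
  -- basis independence of the trace of the compression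
  let G : EuclideanSpace ℂ (Fin M) →L[ℂ] EuclideanSpace ℂ (Fin M) := adjoint J ∘L T ∘L J
  have hG : ∀ x y, (inner ℂ x (G y) : ℂ) = inner ℂ (J x) (L y) := fun x y =>
    adjoint_inner_right J _ _
  have htr : ∑ i, inner ℂ (e i) (T (e i)) = ∑ j, (inner ℂ (J (u j)) (L (u j)) : ℂ) := by
    have h1 := LinearMap.trace_eq_sum_inner (G : _ →ₗ[ℂ] _) (EuclideanSpace.basisFun (Fin M) ℂ)
    have h2 := LinearMap.trace_eq_sum_inner (G : _ →ₗ[ℂ] _) u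
    rw [h1] at h2
    calc
      _ = ∑ i, inner ℂ (EuclideanSpace.basisFun (Fin M) ℂ i)
          (G (EuclideanSpace.basisFun (Fin M) ℂ i)) := by
          refine Finset.sum_congr rfl fun i _ => ?_
          rw [hG, orthonormalEmbedding_basisFun]
          change _ = inner ℂ (e i) (T (J _))
          rw [orthonormalEmbedding_basisFun]
      _ = ∑ j, (inner ℂ (u j) (G (u j)) : ℂ) := h2
      _ = _ := Finset.sum_congr rfl fun j _ => hG _ _
  rw [htr]
  calc _ ≤ ∑ j : Fin M, ‖(inner ℂ (J (u j)) (L (u j)) : ℂ)‖ := norm_sum_le _ _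
    _ ≤ ∑ j : Fin M, singularValue T j := by
      refine Finset.sum_le_sum fun j _ => (norm_inner_le_norm _ _).trans ?_
      rw [hJn, u.orthonormal.1 j, one_mul]
      exact key j
    _ = partialTrace T M := Fin.sum_univ_eq_sum_range (fun j => singularValue T j) M

end KyFan

/-! ### Compact positive operators and positive parts -/

section CompactPositive

variable {H : Type*} [NormedAddCommGroup H] [InnerProductSpace ℂ H] [CompleteSpace H]

open InnerProductSpace ContinuousLinearMap
open scoped ComplexOrder

/-- For a self-adjoint operator some spectral point has modulus ‖P‖; compactness makes it an
eigenvalue, and positivity makes it equal to ‖P‖. -/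
lemma exists_unit_eigenvector_norm {P : H →L[ℂ] H} (hc : IsCompactOperator P) (hP : P.IsPositive)
    (h0 : P ≠ 0) : ∃ v : H, ‖v‖ = 1 ∧ P v = ((‖P‖ : ℝ) : ℂ) • v := by
  have : Nontrivial (H →L[ℂ] H) := ⟨P, 0, h0⟩
  obtain ⟨z, hz, hzn⟩ := spectrum.exists_nnnorm_eq_spectralRadius P
  rw [P.spectralRadius_eq_nnnorm hP.isSelfAdjoint] at hzn
  have hzn' : ‖z‖ = ‖P‖ := by exact_mod_cast congrArg ENNReal.toReal hzn
  have hz0 : z ≠ 0 := by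
    rw [← norm_ne_zero_iff, hzn']; exact norm_ne_zero_iff.mpr h0
  obtain ⟨w, hw⟩ := ((hc.hasEigenvalue_iff_mem_spectrum hz0).mpr hz).exists_hasEigenvector
  have hw0 : 0 < ‖w‖ := norm_pos_iff.mpr hw.2
  have hwz : P w = z • w := hw.apply_eq_smul
  have hin : (inner ℂ w (P w) : ℂ) = z * (‖w‖ ^ 2 : ℝ) := by
    rw [hwz, inner_smul_right, inner_self_eq_norm_sq_to_K]; push_cast; rfl
  have hnn : (0 : ℂ) ≤ z * (‖w‖ ^ 2 : ℝ) := hin ▸ hP.inner_nonneg_right w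
  have hz1 : (0 : ℂ) ≤ z := by
    rw [Complex.le_def] at hnn ⊢
    simp only [Complex.re_mul_ofReal, Complex.im_mul_ofReal, Complex.zero_re,
      Complex.zero_im] at hnn ⊢
    have h2 : 0 < ‖w‖ ^ 2 := by positivity
    exact ⟨nonneg_of_mul_nonneg_left hnn.1 h2,
      ((mul_eq_zero.mp hnn.2.symm).resolve_right h2.ne').symm⟩
  have hz2 : z = ((‖P‖ : ℝ) : ℂ) := by
    rw [← hzn']; exact (Complex.norm_of_nonneg' hz1).symm
  refine ⟨((‖w‖⁻¹ : ℝ) : ℂ) • w, ?_, ?_⟩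
  · rw [norm_smul, Complex.norm_real, norm_inv, norm_norm, inv_mul_cancel₀ hw0.ne']
  · rw [map_smul, hwz, hz2, smul_comm]

/-- The sum of the first `N` singular values of a compact positive operator is bounded by its trace
on the span of at most `N` orthonormal eigenvectors with positive eigenvalues. -/
theorem exists_orthonormal_partialTrace_le (N : ℕ) : ∀ P : H →L[ℂ] H, IsCompactOperator P →
    P.IsPositive → ∃ (M : ℕ) (_ : M ≤ N) (e : Fin M → H), Orthonormal ℂ e ∧
      (∀ i, ∃ l : ℝ, 0 < l ∧ P (e i) = (l : ℂ) • e i) ∧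
      partialTrace P N ≤ ∑ i, (inner ℂ (e i) (P (e i))).re := by
  induction N with
  | zero =>
    intro P _ _
    refine ⟨0, le_rfl, Fin.elim0, ⟨fun i => i.elim0, fun i => i.elim0⟩, fun i => i.elim0, ?_⟩
    simp [partialTrace]
  | succ N ih =>
    intro P hc hP
    by_cases h0 : P = 0
    · subst h0
      refine ⟨0, Nat.zero_le _, Fin.elim0, ⟨fun i => i.elim0, fun i => i.elim0⟩,
        fun i => i.elim0, ?_⟩
      simp only [Finset.univ_eq_empty, Finset.sum_empty]
      exact Finset.sum_nonpos fun j _ => (singularValue_le_norm _ _).trans_eq norm_zero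
    obtain ⟨v, hv1, hPv⟩ := exists_unit_eigenvector_norm hc hP h0
    have hpos : 0 < ‖P‖ := norm_pos_iff.mpr h0
    set l := ‖P‖ with hl
    have hvv : (inner ℂ v v : ℂ) = 1 := by rw [inner_self_eq_norm_sq_to_K, hv1]; simp
    -- Deflation: compressing by the projection off `v` subtracts exactly the top eigenvalue term,
    -- so the remainder is again compact and positive.
    let Q : H →L[ℂ] H := 1 - rankOne ℂ v v
    have hQa : adjoint Q = Q := by
      simp only [Q, map_sub, adjoint_rankOne]
      congr 1
      exact adjoint_id
    have hPvx : ∀ x, (inner ℂ v (P x) : ℂ) = l * inner ℂ v x := fun x => by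
      rw [← hP.isSymmetric.apply_clm v x, hPv, inner_smul_left, Complex.conj_ofReal]
    have hQx : ∀ x, Q x = x - (inner ℂ v x : ℂ) • v := fun x => rfl
    have hQPQ : adjoint Q ∘L P ∘L Q = P - (l : ℂ) • rankOne ℂ v v := by
      rw [hQa]
      ext x
      simp only [ContinuousLinearMap.comp_apply, hQx, _root_.sub_apply, rankOne_apply,
        map_sub, map_smul, hPv, smul_apply, hPvx, inner_sub_right, inner_smul_right, hvv]
      module
    have hP' : (P - (l : ℂ) • rankOne ℂ v v).IsPositive := hQPQ ▸ hP.adjoint_conj Q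
    have hc' : IsCompactOperator (P - (l : ℂ) • rankOne ℂ v v) := by
      rw [← hQPQ]
      exact (hc.comp_clm Q).clm_comp (adjoint Q)
    set P' := P - (l : ℂ) • rankOne ℂ v v with hP'def
    have hPP' : ∀ x, P x = P' x + ((l : ℂ) * inner ℂ v x) • v := fun x => by
      simp only [hP'def, _root_.sub_apply, smul_apply, rankOne_apply, smul_smul]
      abel
    have hP'v : P' v = 0 := by
      have := hPP' v
      rw [hPv, hvv, mul_one] at this
      simpa using this
    obtain ⟨M, hM, e, he, hel, hsum⟩ := ih P' hc' hP'
    -- Here the strict positivity of the eigenvalues is needed: it separates `e i` from the kernel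
    -- of `P'`, which contains `v`.
    have hort : ∀ i, (inner ℂ v (e i) : ℂ) = 0 := fun i => by
      obtain ⟨m, hm, hmi⟩ := hel i
      have h1 : (inner ℂ v (P' (e i)) : ℂ) = 0 := by
        rw [← hP'.isSymmetric.apply_clm v (e i), hP'v, inner_zero_left]
      rw [hmi, inner_smul_right] at h1
      exact (mul_eq_zero.mp h1).resolve_left (by exact_mod_cast hm.ne')
    have hPe : ∀ i, P (e i) = P' (e i) := fun i => by
      rw [hPP', hort, mul_zero, zero_smul, add_zero]
    refine ⟨M + 1, Nat.succ_le_succ hM, Fin.cons v e, ⟨?_, ?_⟩, ?_, ?_⟩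
    · intro i
      refine Fin.cases ?_ (fun i => ?_) i
      · simpa using hv1
      · simpa using he.1 i
    · intro i j hij
      revert hij
      refine Fin.cases ?_ (fun i => ?_) i <;> refine Fin.cases ?_ (fun j => ?_) j
      · simp
      · intro _
        simpa using hort j
      · intro _
        simp only [Fin.cons_succ, Fin.cons_zero]
        rw [← inner_conj_symm, hort, map_zero]
      · intro hij
        simp only [Fin.cons_succ]
        exact he.2 fun h => hij (congrArg Fin.succ h)
    · intro i
      refine Fin.cases ?_ (fun i => ?_) i
      · exact ⟨l, hpos, by simpa using hPv⟩
      · obtain ⟨m, hm, hmi⟩ := hel i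
        exact ⟨m, hm, by simpa [hPe] using hmi⟩
    · rw [Fin.sum_univ_succ]
      simp only [Fin.cons_zero, Fin.cons_succ, hPv, hPe, inner_smul_right, hvv, mul_one,
        Complex.ofReal_re]
      unfold partialTrace
      rw [Finset.sum_range_succ']
      have h1 : ∑ j ∈ Finset.range N, singularValue P (j + 1) ≤ partialTrace P' N := by
        refine Finset.sum_le_sum fun j _ => ?_
        have h2 := singularValue_succ_le_add_rankOne P' ((l : ℂ) • v) v j
        have h3 : P' + rankOne ℂ ((l : ℂ) • v) v = P := by
          rw [hP'def, map_smul]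
          simp
        rwa [h3] at h2
      linarith [singularValue_le_norm P 0]

/-- By ‖Pz‖² = ⟨z, P²z⟩ ≤ ‖z‖ ‖P²z‖ and ‖z‖ ≤ 2 for differences in the unit ball, an ε²/2-net for
the image under P² yields an ε-net for the image under P. -/
lemma isCompactOperator_of_comp_self {P : H →L[ℂ] H} (hP : IsSelfAdjoint P)
    (hc : IsCompactOperator (P ∘L P)) : IsCompactOperator P := by
  refine (isCompactOperator_iff_isCompact_closure_image_ball (𝕜₁ := ℂ)
    (P : H →ₗ[ℂ] H) one_pos).mpr ?_
  have h1 := (isCompactOperator_iff_isCompact_closure_image_ball (𝕜₁ := ℂ)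
    ((P ∘L P : H →L[ℂ] H) : H →ₗ[ℂ] H) one_pos).mp hc
  refine TotallyBounded.isCompact_of_isClosed ?_ isClosed_closure
  refine TotallyBounded.closure ?_
  have h2 : TotallyBounded ((P ∘L P) '' Metric.ball 0 1) :=
    h1.totallyBounded.subset subset_closure
  rw [Metric.totallyBounded_iff]
  intro ε hε
  obtain ⟨t, hts, htf, hcov⟩ := Metric.finite_approx_of_totallyBounded h2 (ε ^ 2 / 2) (by positivity)
  choose! g hg using fun y (hy : y ∈ t) => hts hy
  refine ⟨(fun y => P (g y)) '' t, htf.image _, ?_⟩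
  rintro _ ⟨x, hx, rfl⟩
  obtain ⟨y, hy, hxy⟩ := Set.mem_iUnion₂.mp (hcov ⟨x, hx, rfl⟩)
  refine Set.mem_iUnion₂.mpr ⟨_, ⟨y, hy, rfl⟩, ?_⟩
  obtain ⟨hgb, hgy⟩ := hg y hy
  rw [Metric.mem_ball, dist_eq_norm] at hxy ⊢
  rw [← hgy, ← map_sub] at hxy
  change ‖P x - P (g y)‖ < ε
  rw [← map_sub]
  set z := x - g y with hz
  have hzn : ‖z‖ ≤ 2 := by
    rw [mem_ball_zero_iff] at hx hgb
    exact (norm_sub_le _ _).trans (by linarith)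
  have h3 : ‖P z‖ ^ 2 ≤ ‖z‖ * ‖(P ∘L P) z‖ := by
    have h4 : (inner ℂ (P z) (P z) : ℂ) = inner ℂ z ((P ∘L P) z) := by
      rw [← adjoint_inner_right, ← star_eq_adjoint, hP.star_eq]; rfl
    rw [inner_self_eq_norm_sq_to_K] at h4
    have h5 : ‖(((‖P z‖ : ℝ) : ℂ)) ^ 2‖ = ‖(inner ℂ z ((P ∘L P) z) : ℂ)‖ := congrArg norm h4
    rw [norm_pow, Complex.norm_real, norm_norm] at h5
    rw [h5]
    exact norm_inner_le_norm _ _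
  have h6 : ‖P z‖ ^ 2 < ε ^ 2 := by
    nlinarith [norm_nonneg z, norm_nonneg ((P ∘L P) z)]
  exact lt_of_pow_lt_pow_left₀ 2 hε.le h6

/-- Since S⁺S⁻ = 0, the square of S⁺ is S⁺S, which is compact. -/
lemma isCompactOperator_posPart {S : H →L[ℂ] H} (hS : IsSelfAdjoint S)
    (hc : IsCompactOperator S) : IsCompactOperator (S⁺ : H →L[ℂ] H) := by
  have h0 : (0 : H →L[ℂ] H) ≤ S⁺ := CFC.posPart_nonneg S
  have hpos := (nonneg_iff_isPositive _).mp h0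
  refine isCompactOperator_of_comp_self hpos.isSelfAdjoint ?_
  have h1 : S⁺ ∘L S⁺ = S⁺ ∘L S := by
    change S⁺ * S⁺ = S⁺ * S
    have h2 : S⁺ * (S⁺ - S⁻) = S⁺ * S := by rw [CFC.posPart_sub_negPart S hS]
    rw [← h2, mul_sub, CFC.posPart_mul_negPart, sub_zero]
  rw [h1]
  exact hc.clm_comp (S⁺ : H →L[ℂ] H)

/-- Eigenvectors of S⁺ with positive eigenvalue are killed by S⁻, because S⁻S⁺ = 0; on them S and S⁺
agree. -/
lemma partialTrace_posPart_le {S : H →L[ℂ] H} (hS : IsSelfAdjoint S) (hc : IsCompactOperator S)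
    (N : ℕ) : ∃ (M : ℕ) (_ : M ≤ N) (e : Fin M → H), Orthonormal ℂ e ∧
      partialTrace (S⁺ : H →L[ℂ] H) N ≤ ∑ i, (inner ℂ (e i) (S (e i))).re := by
  have h0 : (0 : H →L[ℂ] H) ≤ S⁺ := CFC.posPart_nonneg S
  obtain ⟨M, hM, e, he, hel, h⟩ := exists_orthonormal_partialTrace_le N (S⁺ : H →L[ℂ] H)
    (isCompactOperator_posPart hS hc) ((nonneg_iff_isPositive _).mp h0)
  refine ⟨M, hM, e, he, h.trans_eq (Finset.sum_congr rfl fun i _ => ?_)⟩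
  obtain ⟨l, hl, hle⟩ := hel i
  have h1 : (S⁻ : H →L[ℂ] H) (e i) = 0 := by
    have h2 : (S⁻ : H →L[ℂ] H) ((S⁺ : H →L[ℂ] H) (e i)) = 0 := by
      change ((S⁻ : H →L[ℂ] H) * S⁺) (e i) = 0
      rw [CFC.negPart_mul_posPart]; rfl
    rw [hle, map_smul] at h2
    exact (smul_eq_zero.mp h2).resolve_left (by exact_mod_cast hl.ne')
  have h3 : S (e i) = (S⁺ : H →L[ℂ] H) (e i) - (S⁻ : H →L[ℂ] H) (e i) := by
    conv_lhs => rw [← CFC.posPart_sub_negPart S hS]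
    rfl
  rw [h3, h1, sub_zero]

/-- S ≤ S⁺ as quadratic forms, and Ky Fan's inequality applies to S⁺. -/
lemma sum_inner_le_partialTrace_posPart {S : H →L[ℂ] H} (hS : IsSelfAdjoint S) {M N : ℕ}
    (hMN : M ≤ N) {e : Fin M → H} (he : Orthonormal ℂ e) :
    ∑ i, (inner ℂ (e i) (S (e i))).re ≤ partialTrace (S⁺ : H →L[ℂ] H) N := by
  have h0 : (0 : H →L[ℂ] H) ≤ S⁻ := CFC.negPart_nonneg S
  have hneg := (nonneg_iff_isPositive _).mp h0
  calc
    _ ≤ ∑ i, (inner ℂ (e i) ((S⁺ : H →L[ℂ] H) (e i))).re := by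
      refine Finset.sum_le_sum fun i _ => ?_
      have h3 : S (e i) = (S⁺ : H →L[ℂ] H) (e i) - (S⁻ : H →L[ℂ] H) (e i) := by
        conv_lhs => rw [← CFC.posPart_sub_negPart S hS]
        rfl
      have h4 := (Complex.le_def.mp (hneg.inner_nonneg_right (e i))).1
      rw [h3, inner_sub_right, Complex.sub_re]
      simp only [Complex.zero_re] at h4
      linarith
    _ = (∑ i, (inner ℂ (e i) ((S⁺ : H →L[ℂ] H) (e i)) : ℂ)).re := (Complex.re_sum _ _).symm
    _ ≤ ‖∑ i, (inner ℂ (e i) ((S⁺ : H →L[ℂ] H) (e i)) : ℂ)‖ := Complex.re_le_norm _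
    _ ≤ partialTrace (S⁺ : H →L[ℂ] H) M := norm_sum_inner_le_partialTrace _ he
    _ ≤ _ := partialTrace_mono _ hMN

/-- Lets both trace bounds be stated with the quadratic form of `T` itself, where sums of operators
split. -/
lemma re_inner_realPart (T : H →L[ℂ] H) (x : H) :
    (inner ℂ x ((realPart T : H →L[ℂ] H) x)).re = (inner ℂ x (T x)).re := by
  rw [realPart_apply_coe, star_eq_adjoint]
  have h : (inner ℂ x (adjoint T x) : ℂ) = (starRingEnd ℂ) (inner ℂ x (T x)) := by
    rw [adjoint_inner_right, inner_conj_symm]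
  have h2 : ((2⁻¹ : ℝ) • (T + adjoint T)) x = ((2⁻¹ : ℝ) : ℂ) • (T x + adjoint T x) := rfl
  rw [h2, inner_smul_right, inner_add_right, h, Complex.re_ofReal_mul, Complex.add_re,
    Complex.conj_re]
  ring

lemma isCompactOperator_realPart_comp (B : H →L[ℂ] H) {A : H →L[ℂ] H} (hA : IsSelfAdjoint A)
    (hc : IsCompactOperator A) : IsCompactOperator (realPart (B ∘L A) : H →L[ℂ] H) := by
  have h : star (B ∘L A) = A ∘L star B := by
    change star (B * A) = _
    rw [star_mul, hA.star_eq]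
    rfl
  have h1 : IsCompactOperator ((2⁻¹ : ℝ) • (B ∘L A + A ∘L star B) : H →L[ℂ] H) :=
    ((hc.clm_comp B).add (hc.comp_clm (star B))).smul (2⁻¹ : ℝ)
  rwa [← h, ← realPart_apply_coe] at h1

/-- The sum of the first `N` singular values of the positive part of the real part of `T`. -/
def posRealTrace (T : H →L[ℂ] H) (N : ℕ) : ℝ :=
  partialTrace ((realPart T : H →L[ℂ] H)⁺) N

lemma exists_posRealTrace_le (B : H →L[ℂ] H) {A : H →L[ℂ] H} (hA : IsSelfAdjoint A)
    (hc : IsCompactOperator A) (N : ℕ) : ∃ (M : ℕ) (_ : M ≤ N) (e : Fin M → H), Orthonormal ℂ e ∧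
      posRealTrace (B ∘L A) N ≤ ∑ i, (inner ℂ (e i) ((B ∘L A) (e i))).re := by
  obtain ⟨M, hM, e, he, h⟩ := partialTrace_posPart_le (realPart (B ∘L A)).2
    (isCompactOperator_realPart_comp B hA hc) N
  simp only [re_inner_realPart] at h
  exact ⟨M, hM, e, he, h⟩

lemma sum_re_inner_le_posRealTrace (T : H →L[ℂ] H) {ι : Type*} {b : ι → H}
    (hb : Orthonormal ℂ b) (F : Finset ι) {N : ℕ} (hF : F.card ≤ N) :
    ∑ k ∈ F, (inner ℂ (b k) (T (b k))).re ≤ posRealTrace T N := by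
  have he : Orthonormal ℂ fun i : Fin F.card => b (F.equivFin.symm i : ι) :=
    hb.comp _ (Subtype.val_injective.comp F.equivFin.symm.injective)
  refine le_of_eq_of_le ?_ (sum_inner_le_partialTrace_posPart (realPart T).2 hF he)
  simp only [re_inner_realPart]
  rw [Equiv.sum_comp F.equivFin.symm (fun p : F => (inner ℂ (b p) (T (b p))).re),
    Finset.sum_coe_sort F (fun p => (inner ℂ (b p) (T (b p))).re)]

end CompactPositive

/-! ### Traces of diagonal operators -/

section DiagonalTrace

variable {ι H : Type*} [NormedAddCommGroup H] [InnerProductSpace ℂ H]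

open InnerProductSpace ContinuousLinearMap

lemma hasSum_re_inner_diag (b : HilbertBasis ι ℂ H) (D : H →L[ℂ] H) (z : ι → ℂ)
    (hD : ∀ x k, b.repr (D x) k = z k * b.repr x k) (x : H) :
    HasSum (fun k => (z k).re * ‖(inner ℂ (b k) x : ℂ)‖ ^ 2) (inner ℂ x (D x)).re := by
  have h := Complex.hasSum_re (b.hasSum_inner_mul_inner x (D x))
  convert h using 2 with k
  have h1 : (inner ℂ (b k) (D x) : ℂ) = z k * inner ℂ (b k) x := by
    rw [← b.repr_apply_apply, hD, b.repr_apply_apply]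
  rw [h1, ← inner_conj_symm x (b k), mul_left_comm, ← Complex.normSq_eq_conj_mul_self,
    Complex.normSq_eq_norm_sq, Complex.re_mul_ofReal]

/-- By Bessel, the masses |⟨b_k, e_i⟩|² sum to at most 1 over i and over k. Writing Re z_k = (Re z_k
- t) + t, the excess costs at most (Re z_k - t)⁺ for each k, and the level t costs at most t for
each of the M vectors. No ordering of the eigenvalues is required. -/
lemma sum_re_inner_diag_le (b : HilbertBasis ι ℂ H) (D : H →L[ℂ] H) (z : ι → ℂ)
    (hD : ∀ x k, b.repr (D x) k = z k * b.repr x k) {t V : ℝ} (ht : 0 ≤ t)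
    (hV : ∀ F : Finset ι, ∑ k ∈ F, max ((z k).re - t) 0 ≤ V) {M : ℕ} {e : Fin M → H}
    (he : Orthonormal ℂ e) : ∑ i, (inner ℂ (e i) (D (e i))).re ≤ V + M * t := by
  have hs := hasSum_sum fun i (_ : i ∈ (Finset.univ : Finset (Fin M))) =>
    hasSum_re_inner_diag b D z hD (e i)
  refine hasSum_le_of_sum_le hs fun F => ?_
  have h1 : ∀ k, ∑ i, ‖(inner ℂ (b k) (e i) : ℂ)‖ ^ 2 ≤ 1 := fun k => by
    have := he.sum_inner_products_le (b k) (s := Finset.univ)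
    rw [b.orthonormal.1 k, one_pow] at this
    simpa only [norm_inner_symm] using this
  have h2 : ∀ i, ∑ k ∈ F, ‖(inner ℂ (b k) (e i) : ℂ)‖ ^ 2 ≤ 1 := fun i => by
    have := b.orthonormal.sum_inner_products_le (e i) (s := F)
    rwa [he.1 i, one_pow] at this
  calc
    _ = ∑ k ∈ F, (z k).re * ∑ i, ‖(inner ℂ (b k) (e i) : ℂ)‖ ^ 2 := by
      refine Finset.sum_congr rfl fun k _ => ?_
      rw [Finset.mul_sum]
    _ ≤ ∑ k ∈ F, (max ((z k).re - t) 0 + t * ∑ i, ‖(inner ℂ (b k) (e i) : ℂ)‖ ^ 2) := by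
      refine Finset.sum_le_sum fun k _ => ?_
      have h0 : 0 ≤ ∑ i, ‖(inner ℂ (b k) (e i) : ℂ)‖ ^ 2 := Finset.sum_nonneg fun _ _ => sq_nonneg _
      have h3 := le_max_left ((z k).re - t) 0
      have h4 := le_max_right ((z k).re - t) 0
      nlinarith [h1 k]
    _ = ∑ k ∈ F, max ((z k).re - t) 0 + t * ∑ i, ∑ k ∈ F, ‖(inner ℂ (b k) (e i) : ℂ)‖ ^ 2 := by
      rw [Finset.sum_add_distrib, ← Finset.mul_sum, Finset.sum_comm]
    _ ≤ V + t * ∑ _i : Fin M, 1 := by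
      gcongr with i
      · exact hV F
      · exact h2 i
    _ = V + M * t := by simp [mul_comm]

lemma isCompactOperator_rankOne (x y : H) : IsCompactOperator (rankOne ℂ x y : H →L[ℂ] H) := by
  have h : IsCompactOperator (innerSL ℂ y : H →L[ℂ] ℂ) :=
    isCompactOperator_of_locallyCompactSpace_dom (innerSL ℂ y : H →L[ℂ] ℂ)
  exact h.clm_comp (ContinuousLinearMap.toSpanSingleton ℂ x)

lemma isPositive_diagOp (b : HilbertBasis ι ℂ H) (a : ι → ℝ) {C : ℝ} (ha : ∀ k, |a k| ≤ C)
    (h0 : ∀ k, 0 ≤ a k) : (diagOp b a ha).IsPositive := by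
  refine ⟨fun x y => ?_, fun x => ?_⟩
  · have h1 := b.hasSum_inner_mul_inner (diagOp b a ha x) y
    have h2 := b.hasSum_inner_mul_inner x (diagOp b a ha y)
    have h3 : ∀ k v, (inner ℂ (b k) (diagOp b a ha v) : ℂ) = a k * inner ℂ (b k) v := fun k v => by
      rw [← b.repr_apply_apply, diagOp_repr, b.repr_apply_apply]
    have h4 : (fun k => (inner ℂ (diagOp b a ha x) (b k) : ℂ) * inner ℂ (b k) y)
        = fun k => inner ℂ x (b k) * inner ℂ (b k) (diagOp b a ha y) := by
      funext k
      rw [h3, ← inner_conj_symm (diagOp b a ha x) (b k), h3, ← inner_conj_symm x (b k), map_mul,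
        Complex.conj_ofReal]
      ring
    rw [h4] at h1
    exact h1.unique h2
  · have := hasSum_re_inner_diag b (diagOp b a ha) (fun k => (a k : ℂ)) (diagOp_repr b a ha) x
    rw [reApplyInnerSelf_apply, inner_re_symm]
    exact this.nonneg fun k => mul_nonneg (by simpa using h0 k) (sq_nonneg _)

variable [CompleteSpace H]

/-- Keeping only the entries above 1/(n+1) in modulus gives finite-rank operators that converge in
norm. -/
lemma isCompactOperator_diagOp (b : HilbertBasis ι ℂ H) (a : ι → ℝ) {C : ℝ}
    (ha : ∀ k, |a k| ≤ C) (hfin : ∀ t : ℝ, 0 < t → {k | t < |a k|}.Finite) :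
    IsCompactOperator (diagOp b a ha) := by
  classical
  have hz : ∀ n : ℕ, (0 : ℝ) < 1 / (n + 1) := fun n => by positivity
  let F : ℕ → Finset ι := fun n => (hfin _ (hz n)).toFinset
  let D : ℕ → H →L[ℂ] H := fun n => ∑ k ∈ F n, (a k : ℂ) • rankOne ℂ (b k) (b k)
  have hD : ∀ n, IsCompactOperator (D n) := fun n =>
    (compactOperator (RingHom.id ℂ) H H).sum_mem fun k _ =>
      (compactOperator (RingHom.id ℂ) H H).smul_mem _ (isCompactOperator_rankOne (b k) (b k))
  have hDr : ∀ n x k, b.repr (D n x) k = (if k ∈ F n then (a k : ℂ) else 0) * b.repr x k := by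
    intro n x k
    rw [b.repr_apply_apply, b.repr_apply_apply]
    simp only [D, _root_.sum_apply, inner_sum, smul_apply, rankOne_apply,
      inner_smul_right]
    rw [ite_mul, zero_mul, ← Finset.sum_ite_eq (F n) k fun j => (a j : ℂ) * inner ℂ (b j) x]
    refine Finset.sum_congr rfl fun j _ => ?_
    rw [orthonormal_iff_ite.mp b.orthonormal k j]
    split_ifs with h
    · subst h; ring
    · ring
  have hw : ∀ n k, |if k ∈ F n then 0 else a k| ≤ 1 / ((n : ℝ) + 1) := by
    intro n k
    split_ifs with h
    · rw [abs_zero]; exact (hz n).le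
    · exact not_lt.mp fun h' => h ((Set.Finite.mem_toFinset _).mpr h')
  have hsub : ∀ n, diagOp b a ha - D n = diagOp b _ (hw n) := by
    intro n
    ext x
    apply b.repr.injective
    ext k
    rw [diagOp_repr, _root_.sub_apply, map_sub, lp.coeFn_sub, Pi.sub_apply, hDr, diagOp_repr]
    split_ifs <;> simp
  refine isCompactOperator_of_tendsto (F := D) (l := atTop) ?_ (Eventually.of_forall hD)
  rw [tendsto_iff_norm_sub_tendsto_zero]
  refine squeeze_zero (fun _ => norm_nonneg _) (fun n => ?_) tendsto_one_div_add_atTop_nhds_zero_nat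
  rw [norm_sub_rev, hsub]
  exact norm_diagOp_le b _ (hz n).le (hw n)

lemma partialTrace_diagOp_le (b : HilbertBasis ι ℂ H) (a : ι → ℝ) {C : ℝ} (ha : ∀ k, |a k| ≤ C)
    (hfin : ∀ t : ℝ, 0 < t → {k | t < |a k|}.Finite) (h0 : ∀ k, 0 ≤ a k) {t V : ℝ} (ht : 0 ≤ t)
    (hV : ∀ F : Finset ι, ∑ k ∈ F, max (a k - t) 0 ≤ V) (N : ℕ) :
    partialTrace (diagOp b a ha) N ≤ V + N * t := by
  obtain ⟨M, hM, e, he, -, h⟩ := exists_orthonormal_partialTrace_le N _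
    (isCompactOperator_diagOp b a ha hfin) (isPositive_diagOp b a ha h0)
  refine h.trans ((sum_re_inner_diag_le b _ (fun k => (a k : ℂ)) (diagOp_repr b a ha) ht
    (by simpa using hV) he).trans ?_)
  gcongr

end DiagonalTrace

/-! ### Eigenbasis and eigenvalues of the Dirac operator -/

section GasketOperators

/-- The orthonormal basis of eigenvectors of the Dirac operator of the gasket. -/
def gasketVec (p : Word × ℤ) : GasketL2 :=
  lp.single (E := fun w : Word => CircleL2 w.1) 2 p.1 (fourierBasis (T := circ p.1.1) p.2)

lemma inner_gasketVec (p : Word × ℤ) (x : GasketL2) :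
    (inner ℂ (gasketVec p) x : ℂ) = inner ℂ (fourierBasis (T := circ p.1.1) p.2) (x p.1) :=
  lp.inner_single_left _ _ _

lemma orthonormal_gasketVec : Orthonormal ℂ gasketVec := by
  classical
  rw [orthonormal_iff_ite]
  rintro ⟨w, k⟩ ⟨v, j⟩
  rw [inner_gasketVec]
  by_cases h : w = v
  · subst h
    have h1 : (gasketVec (w, j) : ∀ w : Word, CircleL2 w.1) w = fourierBasis (T := circ w.1) j :=
      lp.single_apply_self _ _ _
    rw [h1, orthonormal_iff_ite.mp (fourierBasis (T := circ w.1)).orthonormal]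
    simp
  · have h1 : (gasketVec (v, j) : ∀ w : Word, CircleL2 w.1) w = 0 :=
      lp.single_apply_ne _ _ _ h
    change (inner ℂ _ ((gasketVec (v, j) : ∀ w : Word, CircleL2 w.1) w) : ℂ) = _
    rw [h1, inner_zero_right, if_neg]
    simp [h]

/-- The Hilbert basis of eigenvectors of the Dirac operator of the gasket. -/
def gasketBasis : HilbertBasis (Word × ℤ) ℂ GasketL2 :=
  HilbertBasis.mkOfOrthogonalEqBot orthonormal_gasketVec (by
    rw [Submodule.eq_bot_iff]
    intro x hx
    ext w : 2
    apply (fourierBasis (T := circ w.1)).repr.injective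
    ext k
    rw [HilbertBasis.repr_apply_apply, ← inner_gasketVec (w, k) x,
      hx _ (Submodule.subset_span ⟨(w, k), rfl⟩)]
    simp)

lemma gasketBasis_apply (p : Word × ℤ) : gasketBasis p = gasketVec p := by
  simp [gasketBasis]

lemma gasketBasis_repr (x : GasketL2) (p : Word × ℤ) :
    gasketBasis.repr x p = (fourierBasis (T := circ p.1.1)).repr (x p.1) p.2 := by
  rw [HilbertBasis.repr_apply_apply, gasketBasis_apply, inner_gasketVec,
    HilbertBasis.repr_apply_apply]

lemma eq_diagOp_gasketBasis {D : GasketL2 →L[ℂ] GasketL2} {a : Word × ℤ → ℝ} {C : ℝ}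
    (ha : ∀ p, |a p| ≤ C) (hD : ∀ x p, gasketBasis.repr (D x) p = a p * gasketBasis.repr x p) :
    D = diagOp gasketBasis a ha := by
  ext1 x
  apply gasketBasis.repr.injective
  ext p
  rw [hD, diagOp_repr]

/-- The eigenvalues of `|D|^{-log 3 / log 2}`. -/
def gasketWeight (p : Word × ℤ) : ℝ := |circleEigenvalue p.1.1 p.2| ^ (-gasketDim)

lemma gasketAbsPow_repr (x : GasketL2) (p : Word × ℤ) :
    gasketBasis.repr (gasketAbsPow gasketDim_nonneg x) p
      = gasketWeight p * gasketBasis.repr x p := by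
  rw [gasketBasis_repr, gasketBasis_repr]
  exact diagOp_repr fourierBasis _ (abs_eigenvalue_rpow_le gasketDim_nonneg p.1.1) (x p.1) p.2

lemma one_lt_gasketDim : 1 < gasketDim := by
  rw [gasketDim, one_lt_div (Real.log_pos (by norm_num))]
  exact Real.log_lt_log (by norm_num) (by norm_num)

lemma two_rpow_gasketDim : (2 : ℝ) ^ gasketDim = 3 := by
  have h2 : Real.log 2 ≠ 0 := (Real.log_pos (by norm_num)).ne'
  rw [Real.rpow_def_of_pos (by norm_num), gasketDim, mul_div_cancel₀ _ h2,
    Real.exp_log (by norm_num)]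

/-- The exponent is chosen so that 2^d = 3: the scale 2^n becomes 3^{-n}, inverse to the number of
words of length n, and the factor 1/2 of the eigenvalue becomes 3. -/
lemma gasketWeight_eq (p : Word × ℤ) :
    gasketWeight p = (3 ^ p.1.1)⁻¹ * (3 * |2 * (p.2 : ℝ) + 1| ^ (-gasketDim)) := by
  have h : |circleEigenvalue p.1.1 p.2| = 2 ^ p.1.1 * (2⁻¹ * |2 * (p.2 : ℝ) + 1|) := by
    have : circleEigenvalue p.1.1 p.2 = 2 ^ p.1.1 * (2⁻¹ * (2 * (p.2 : ℝ) + 1)) := by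
      unfold circleEigenvalue; field_simp
    rw [this, abs_mul, abs_mul, abs_of_pos (by positivity : (0 : ℝ) < 2 ^ p.1.1),
      abs_of_pos (by norm_num : (0 : ℝ) < 2⁻¹)]
  rw [gasketWeight, h, Real.mul_rpow (by positivity) (by positivity),
    Real.mul_rpow (by positivity) (by positivity)]
  congr 2
  · rw [← Real.rpow_natCast, ← Real.rpow_mul (by norm_num), mul_comm, Real.rpow_mul (by norm_num),
      Real.rpow_neg (by norm_num), two_rpow_gasketDim, Real.rpow_natCast, inv_pow]
  · rw [Real.inv_rpow (by norm_num), Real.rpow_neg (by norm_num), two_rpow_gasketDim, inv_inv]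

lemma gasketWeight_nonneg (p : Word × ℤ) : 0 ≤ gasketWeight p :=
  Real.rpow_nonneg (abs_nonneg _) _

lemma one_le_abs_odd (k : ℤ) : (1 : ℝ) ≤ |2 * (k : ℝ) + 1| := by
  have : (1 : ℤ) ≤ |2 * k + 1| := Int.one_le_abs (by omega)
  exact_mod_cast this

lemma gasketWeight_le (p : Word × ℤ) : gasketWeight p ≤ 3 * (3 ^ p.1.1)⁻¹ := by
  rw [gasketWeight_eq, ← mul_assoc, mul_comm (3 : ℝ)]
  refine mul_le_of_le_one_right (by positivity) ?_
  exact Real.rpow_le_one_of_one_le_of_nonpos (one_le_abs_odd _) (by linarith [gasketDim_nonneg])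

end GasketOperators

/-! ### Zeta constant and logarithmic counting of levels -/

section Asymptotics

/-- The mean of a function of words over the words of length `l`. -/
def wordMean (g : Word → ℝ) (l : ℕ) : ℝ := (3 ^ l)⁻¹ * ∑ w : Fin l → Fin 3, g ⟨l, w⟩

/-- The real number `ζ(log 3 / log 2)`. -/
def zetaDim : ℝ := ∑' n : ℕ, (n : ℝ) ^ (-gasketDim)

/-- d > 1 is in the range of convergence of the Dirichlet series; the terms with n = 0 vanish on
both sides by convention. -/
lemma riemannZeta_gasketDim :
    riemannZeta ((Real.log 3 / Real.log 2 : ℝ) : ℂ) = (zetaDim : ℂ) := by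
  change riemannZeta ((gasketDim : ℝ) : ℂ) = _
  rw [zeta_eq_tsum_one_div_nat_cpow (by simpa using one_lt_gasketDim), zetaDim, Complex.ofReal_tsum]
  refine tsum_congr fun n => ?_
  rw [Complex.ofReal_cpow (Nat.cast_nonneg n), one_div, Complex.ofReal_neg, Complex.cpow_neg,
    Complex.ofReal_natCast]

lemma summable_nat_rpow_neg_gasketDim : Summable fun n : ℕ => (n : ℝ) ^ (-gasketDim) :=
  Real.summable_nat_rpow.mpr (by linarith [one_lt_gasketDim])

lemma two_rpow_neg_gasketDim : (2 : ℝ) ^ (-gasketDim) = 3⁻¹ := by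
  rw [Real.rpow_neg (by norm_num), two_rpow_gasketDim]

/-- The even terms sum to 2^{-d} ζ(d) = ζ(d)/3. -/
lemma hasSum_nat_odd_rpow :
    HasSum (fun n : ℕ => (2 * (n : ℝ) + 1) ^ (-gasketDim)) (2 / 3 * zetaDim) := by
  have hs : HasSum (fun n : ℕ => (n : ℝ) ^ (-gasketDim)) zetaDim :=
    summable_nat_rpow_neg_gasketDim.hasSum
  have h1 : Summable fun n : ℕ => ((2 * n + 1 : ℕ) : ℝ) ^ (-gasketDim) :=
    summable_nat_rpow_neg_gasketDim.comp_injective (i := fun n => 2 * n + 1)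
      fun a b h => by simpa using h
  have e1 : (fun n : ℕ => ((2 * n + 1 : ℕ) : ℝ) ^ (-gasketDim))
      = fun n : ℕ => (2 * (n : ℝ) + 1) ^ (-gasketDim) := by
    funext n; push_cast; rfl
  have e2 : (fun n : ℕ => ((2 * n : ℕ) : ℝ) ^ (-gasketDim))
      = fun n : ℕ => 3⁻¹ * (n : ℝ) ^ (-gasketDim) := by
    funext n
    rw [Nat.cast_mul, Real.mul_rpow (by norm_num) (Nat.cast_nonneg n), Nat.cast_ofNat,
      two_rpow_neg_gasketDim]
  have heven : HasSum (fun n : ℕ => ((2 * n : ℕ) : ℝ) ^ (-gasketDim)) (3⁻¹ * zetaDim) :=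
    e2 ▸ hs.mul_left _
  obtain ⟨c, hc⟩ := h1
  have h2 : 3⁻¹ * zetaDim + c = zetaDim :=
    HasSum.unique (HasSum.even_add_odd (f := fun n : ℕ => (n : ℝ) ^ (-gasketDim)) heven hc) hs
  have h3 : c = 2 / 3 * zetaDim := by linarith
  rwa [h3, e1] at hc

/-- Source of the constant 4: the frequencies k ≥ 0 and k < 0 each contribute 3 · (2/3) ζ(d). -/
lemma hasSum_odd_rpow :
    HasSum (fun k : ℤ => 3 * |2 * (k : ℝ) + 1| ^ (-gasketDim)) (4 * zetaDim) := by
  have e1 : (fun n : ℕ => |2 * (((n : ℕ) : ℤ) : ℝ) + 1| ^ (-gasketDim))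
      = fun n : ℕ => (2 * (n : ℝ) + 1) ^ (-gasketDim) := by
    funext n
    rw [Int.cast_natCast, abs_of_nonneg (by positivity)]
  have e2 : (fun n : ℕ => |2 * ((-((n : ℤ) + 1) : ℤ) : ℝ) + 1| ^ (-gasketDim))
      = fun n : ℕ => (2 * (n : ℝ) + 1) ^ (-gasketDim) := by
    funext n
    have : (2 * ((-((n : ℤ) + 1) : ℤ) : ℝ) + 1) = -(2 * (n : ℝ) + 1) := by push_cast; ring
    rw [this, abs_neg, abs_of_nonneg (by positivity)]
  have h3 := HasSum.of_nat_of_neg_add_one (f := fun k : ℤ => |2 * (k : ℝ) + 1| ^ (-gasketDim))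
    (e1 ▸ hasSum_nat_odd_rpow) (e2 ▸ hasSum_nat_odd_rpow)
  have h4 := h3.mul_left 3
  have h5 : 3 * (2 / 3 * zetaDim + 2 / 3 * zetaDim) = 4 * zetaDim := by ring
  rwa [h5] at h4

/-- The words of length less than `L`. -/
def shortWords (L : ℕ) : Finset Word := (Finset.range L).sigma fun _ => Finset.univ

lemma mem_shortWords {L : ℕ} {w : Word} : w ∈ shortWords L ↔ w.1 < L := by
  simp [shortWords]

lemma card_shortWords_le (L : ℕ) : (shortWords L).card ≤ 3 ^ L := by
  rw [shortWords, Finset.card_sigma]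
  simp only [Finset.card_univ, Fintype.card_fun, Fintype.card_fin]
  have := Nat.geomSum_lt (m := 3) (n := L) (s := Finset.range L) (by norm_num) (by simp)
  exact this.le

/-- The factor 3^{-l} of the weight turns the sum over words of length l into a mean, so frequencies
and levels separate. -/
lemma sum_shortWords_product (g : Word → ℝ) (L : ℕ) (Z : Finset ℤ) :
    ∑ p ∈ shortWords L ×ˢ Z, g p.1 * gasketWeight p
      = (∑ k ∈ Z, 3 * |2 * (k : ℝ) + 1| ^ (-gasketDim)) * ∑ l ∈ Finset.range L, wordMean g l := by
  rw [Finset.sum_product, shortWords, Finset.sum_sigma, Finset.mul_sum]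
  refine Finset.sum_congr rfl fun l _ => ?_
  rw [wordMean, Finset.mul_sum, Finset.mul_sum]
  refine Finset.sum_congr rfl fun w _ => ?_
  simp only [gasketWeight_eq]
  rw [Finset.sum_mul]
  refine Finset.sum_congr rfl fun k _ => ?_
  ring

lemma wordMean_nonneg {g : Word → ℝ} (hg : ∀ w, 0 ≤ g w) (l : ℕ) : 0 ≤ wordMean g l :=
  mul_nonneg (by positivity) (Finset.sum_nonneg fun _ _ => hg _)

/-- On level l the weighted eigenvalue is at most 3K · 3^{-l}, which is below the threshold 1/N once
3^l ≥ 3KN. The finitely many remaining levels are bounded by their full frequency sum. -/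
lemma sum_max_weight_le (g : Word → ℝ) {K : ℕ} (hg : ∀ w, g w ≤ K) {N : ℕ} (hN : 1 ≤ N)
    (F : Finset (Word × ℤ)) :
    ∑ p ∈ F, max (g p.1 * gasketWeight p - (N : ℝ)⁻¹) 0
      ≤ 4 * zetaDim * ∑ l ∈ Finset.range (Nat.clog 3 (3 * K * N)),
          wordMean (fun w => max (g w) 0) l := by
  classical
  set L := Nat.clog 3 (3 * K * N) with hL
  have hNpos : (0 : ℝ) < N := by exact_mod_cast hN
  have hKN : (3 * K * N : ℝ) ≤ 3 ^ L := by
    exact_mod_cast Nat.le_pow_clog (by norm_num) (3 * K * N)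
  have hlong : ∀ p : Word × ℤ, p.1 ∉ shortWords L →
      max (g p.1 * gasketWeight p - (N : ℝ)⁻¹) 0 = 0 := by
    intro p hp
    rw [mem_shortWords, not_lt] at hp
    refine max_eq_right (sub_nonpos.mpr ?_)
    have h1 : (3 : ℝ) ^ L ≤ 3 ^ p.1.1 := pow_le_pow_right₀ (by norm_num) hp
    calc g p.1 * gasketWeight p ≤ K * (3 * (3 ^ p.1.1)⁻¹) :=
          mul_le_mul (hg _) (gasketWeight_le p) (gasketWeight_nonneg p) (Nat.cast_nonneg K)
      _ = (3 * K) / 3 ^ p.1.1 := by ring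
      _ ≤ (N : ℝ)⁻¹ := by
        rw [div_le_iff₀ (by positivity), inv_mul_eq_div, le_div_iff₀ hNpos]
        exact hKN.trans h1
  have hterm : ∀ p : Word × ℤ, max (g p.1 * gasketWeight p - (N : ℝ)⁻¹) 0
      ≤ max (g p.1) 0 * gasketWeight p := by
    intro p
    have h0 := gasketWeight_nonneg p
    refine max_le ?_ (mul_nonneg (le_max_right _ _) h0)
    have : 0 < (N : ℝ)⁻¹ := by positivity
    nlinarith [mul_le_mul_of_nonneg_right (le_max_left (g p.1) 0) h0]
  calc _ = ∑ p ∈ F with p.1 ∈ shortWords L, max (g p.1 * gasketWeight p - (N : ℝ)⁻¹) 0 := by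
        rw [Finset.sum_filter]
        refine Finset.sum_congr rfl fun p _ => ?_
        split_ifs with h
        · rfl
        · exact hlong p h
    _ ≤ ∑ p ∈ F with p.1 ∈ shortWords L, max (g p.1) 0 * gasketWeight p :=
        Finset.sum_le_sum fun p _ => hterm p
    _ ≤ ∑ p ∈ shortWords L ×ˢ F.image Prod.snd, max (g p.1) 0 * gasketWeight p := by
        refine Finset.sum_le_sum_of_subset_of_nonneg ?_ fun p _ _ =>
          mul_nonneg (le_max_right _ _) (gasketWeight_nonneg p)
        intro p hp
        rw [Finset.mem_filter] at hp
        exact Finset.mem_product.mpr ⟨hp.2, Finset.mem_image_of_mem _ hp.1⟩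
    _ ≤ _ := by
        rw [sum_shortWords_product (fun w => max (g w) 0)]
        refine mul_le_mul_of_nonneg_right ?_
          (Finset.sum_nonneg fun l _ => wordMean_nonneg (fun w => le_max_right _ _) l)
        exact sum_le_hasSum _ (fun k _ => by positivity) hasSum_odd_rpow

lemma tendsto_log_natCast : Tendsto (fun N : ℕ => Real.log N) atTop atTop :=
  Real.tendsto_log_atTop.comp tendsto_natCast_atTop_atTop

lemma tendsto_div_log {L : ℕ → ℕ} {C : ℝ}
    (hL : ∀ᶠ N : ℕ in atTop, |L N * Real.log 3 - Real.log N| ≤ C) :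
    Tendsto (fun N => (L N : ℝ) / Real.log N) atTop (𝓝 (1 / Real.log 3)) := by
  have h3 : 0 < Real.log 3 := Real.log_pos (by norm_num)
  have h1 : Tendsto (fun N : ℕ => (L N * Real.log 3 - Real.log N) / Real.log N) atTop (𝓝 0) := by
    refine squeeze_zero_norm' ?_ (tendsto_log_natCast.const_div_atTop C)
    filter_upwards [hL, tendsto_log_natCast.eventually_gt_atTop 0] with N hN hpos
    rw [norm_div, Real.norm_eq_abs, Real.norm_of_nonneg hpos.le]
    gcongr
  have h2 := (h1.add_const 1).div_const (Real.log 3)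
  rw [zero_add] at h2
  refine h2.congr' ?_
  filter_upwards [tendsto_log_natCast.eventually_gt_atTop 0] with N hpos
  field_simp
  ring

/-- Cesàro means: a sum over L(N) ~ log N / log 3 levels behaves like c · L(N). -/
lemma tendsto_sum_range_div_log {G : ℕ → ℝ} {c : ℝ} (hG : Tendsto G atTop (𝓝 c)) {L : ℕ → ℕ}
    (hL : Tendsto (fun N => (L N : ℝ) / Real.log N) atTop (𝓝 (1 / Real.log 3))) :
    Tendsto (fun N : ℕ => (∑ l ∈ Finset.range (L N), G l) / Real.log N) atTop
      (𝓝 (c / Real.log 3)) := by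
  have h3 : 0 < 1 / Real.log 3 := by
    have : 0 < Real.log 3 := Real.log_pos (by norm_num)
    positivity
  have hLtop : Tendsto L atTop atTop := by
    have h1 := hL.pos_mul_atTop h3 tendsto_log_natCast
    refine tendsto_natCast_atTop_iff.mp (h1.congr' ?_)
    filter_upwards [tendsto_log_natCast.eventually_gt_atTop 0] with N hpos
    exact div_mul_cancel₀ _ hpos.ne'
  have h1 := (hG.cesaro.comp hLtop).mul hL
  rw [mul_one_div] at h1
  refine h1.congr' ?_
  filter_upwards [hLtop.eventually_gt_atTop 0] with N hN
  have : (L N : ℝ) ≠ 0 := by exact_mod_cast hN.ne'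
  simp only [Function.comp_apply]
  field_simp

lemma tendsto_clog_div_log {K : ℕ} (hK : 1 ≤ K) :
    Tendsto (fun N : ℕ => (Nat.clog 3 (K * N) : ℝ) / Real.log N) atTop (𝓝 (1 / Real.log 3)) := by
  refine tendsto_div_log (C := Real.log K + Real.log 3) ?_
  filter_upwards [eventually_ge_atTop 2] with N hN
  have h3 : 0 < Real.log 3 := Real.log_pos (by norm_num)
  have hN0 : (0 : ℝ) < N := by positivity
  have hK0 : (0 : ℝ) < K := by exact_mod_cast hK
  have hKl : 0 ≤ Real.log K := Real.log_natCast_nonneg K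
  have h1 : (K * N : ℝ) ≤ 3 ^ Nat.clog 3 (K * N) := by
    exact_mod_cast Nat.le_pow_clog (by norm_num) (K * N)
  have h2 : (3 : ℝ) ^ (Nat.clog 3 (K * N) - 1) < K * N := by
    exact_mod_cast Nat.pow_pred_clog_lt_self (b := 3) (by norm_num) (by nlinarith)
  have h1' := Real.log_le_log (by positivity) h1
  have h2' := Real.log_lt_log (by positivity) h2
  rw [Real.log_mul hK0.ne' hN0.ne', Real.log_pow] at h1' h2'
  have h4 : (Nat.clog 3 (K * N) : ℝ) ≤ ((Nat.clog 3 (K * N) - 1 : ℕ) : ℝ) + 1 := by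
    exact_mod_cast Nat.le_add_of_sub_le le_rfl
  rw [abs_le]
  constructor <;> nlinarith

lemma tendsto_nat_log_div_log {m : ℕ} (hm : 1 ≤ m) :
    Tendsto (fun N : ℕ => (Nat.log 3 (N / m) : ℝ) / Real.log N) atTop (𝓝 (1 / Real.log 3)) := by
  refine tendsto_div_log (C := Real.log m + Real.log 3) ?_
  filter_upwards [eventually_ge_atTop m] with N hN
  have h3 : 0 < Real.log 3 := Real.log_pos (by norm_num)
  have hm0 : (0 : ℝ) < m := by exact_mod_cast hm
  have hN0 : (0 : ℝ) < N := hm0.trans_le (by exact_mod_cast hN)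
  have hml : 0 ≤ Real.log m := Real.log_natCast_nonneg m
  have h1 : (3 : ℝ) ^ Nat.log 3 (N / m) ≤ N := by
    have := (Nat.pow_log_le_self 3 (Nat.div_pos hN hm).ne').trans (Nat.div_le_self N m)
    exact_mod_cast this
  have h2 : (N : ℝ) < 3 ^ (Nat.log 3 (N / m) + 1) * m := by
    have := (Nat.div_lt_iff_lt_mul hm).mp (Nat.lt_pow_succ_log_self (b := 3) (by norm_num) (N / m))
    exact_mod_cast this
  have h1' := Real.log_le_log (by positivity) h1
  have h2' := Real.log_lt_log hN0 h2
  rw [Real.log_pow] at h1'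
  rw [Real.log_mul (by positivity) hm0.ne', Real.log_pow] at h2'
  push_cast at h2'
  rw [abs_le]
  constructor <;> nlinarith

end Asymptotics

/-! ### Diagonal part plus oscillation, and the trace asymptotics -/

section Decomposition

open ContinuousLinearMap

lemma mulOp_sub_const (n : ℕ) (g : C(Circ n, ℂ)) (c : ℂ) (ξ : CircleL2 n) :
    mulOp n (g - ContinuousMap.const _ c) ξ = mulOp n g ξ - c • ξ := by
  apply Lp.ext
  filter_upwards [mulOp_ae n (g - ContinuousMap.const _ c) ξ, mulOp_ae n g ξ,
    Lp.coeFn_sub (mulOp n g ξ) (c • ξ), Lp.coeFn_smul c ξ] with t h1 h2 h3 h4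
  rw [h1, h3, Pi.sub_apply, h2, h4, Pi.smul_apply, smul_eq_mul]
  simp [sub_mul]

/-- The value of `f` at the lower right corner of a triangle. -/
def cornerValue (f : C(gasket, ℂ)) (w : Word) : ℂ := f (gasketPath w.1 w.2 0)

/-- The oscillation of `f` on a triangle, measured from its lower right corner. -/
def cornerOsc (f : C(gasket, ℂ)) (w : Word) : ℝ :=
  ‖f.comp (gasketPath w.1 w.2) - ContinuousMap.const _ (cornerValue f w)‖

lemma cornerOsc_nonneg (f : C(gasket, ℂ)) (w : Word) : 0 ≤ cornerOsc f w := norm_nonneg _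

lemma norm_cornerValue_le (f : C(gasket, ℂ)) (w : Word) : ‖cornerValue f w‖ ≤ ‖f‖ :=
  f.norm_coe_le_norm _

lemma cornerOsc_le (f : C(gasket, ℂ)) (w : Word) : cornerOsc f w ≤ 2 * ‖f‖ := by
  refine (ContinuousMap.norm_le _ (by positivity)).mpr fun t => ?_
  have h1 : ‖f (gasketPath w.1 w.2 t)‖ ≤ ‖f‖ := f.norm_coe_le_norm _
  have h2 := norm_cornerValue_le f w
  change ‖f (gasketPath w.1 w.2 t) - cornerValue f w‖ ≤ _
  exact (norm_sub_le _ _).trans (by linarith)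

lemma gasketWeight_le_three (p : Word × ℤ) : gasketWeight p ≤ 3 := by
  refine (gasketWeight_le p).trans (mul_le_of_le_one_right (by norm_num) ?_)
  exact inv_le_one_of_one_le₀ (one_le_pow₀ (by norm_num))

lemma abs_mul_gasketWeight_le {g : Word → ℝ} {K : ℝ} (hK : ∀ w, |g w| ≤ K) (p : Word × ℤ) :
    |g p.1 * gasketWeight p| ≤ K * 3 := by
  rw [abs_mul, abs_of_nonneg (gasketWeight_nonneg p)]
  exact mul_le_mul (hK _) (gasketWeight_le_three p) (gasketWeight_nonneg p)
    ((abs_nonneg _).trans (hK p.1))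

lemma abs_cornerOsc_le (f : C(gasket, ℂ)) (w : Word) : |cornerOsc f w| ≤ 2 * ‖f‖ := by
  rw [abs_of_nonneg (cornerOsc_nonneg f w)]
  exact cornerOsc_le f w

/-- The operator that multiplies the eigenvectors of a triangle by the oscillation of `f`, times
the eigenvalue of `|D|^{-log 3 / log 2}`. -/
def oscOp (f : C(gasket, ℂ)) : GasketL2 →L[ℂ] GasketL2 :=
  diagOp gasketBasis (fun p => cornerOsc f p.1 * gasketWeight p)
    (abs_mul_gasketWeight_le (abs_cornerOsc_le f))

lemma norm_cornerOp_le (f : C(gasket, ℂ)) (w : Word) :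
    ‖cornerValue f w • ContinuousLinearMap.id ℂ (CircleL2 w.1)‖ ≤ ‖f‖ := by
  refine (norm_smul _ _).trans_le ?_
  have h1 := norm_cornerValue_le f w
  have h2 : ‖ContinuousLinearMap.id ℂ (CircleL2 w.1)‖ ≤ 1 := norm_id_le
  nlinarith [norm_nonneg (cornerValue f w)]

/-- Multiplication by `cornerValue f w` on the summand of the triangle `w`. -/
def cornerOp (f : C(gasket, ℂ)) : GasketL2 →L[ℂ] GasketL2 :=
  blockDiag (fun w : Word => cornerValue f w • ContinuousLinearMap.id ℂ (CircleL2 w.1))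
    (norm_cornerOp_le f)

lemma norm_fluctuation_le (f : C(gasket, ℂ)) (w : Word) :
    ‖(((cornerOsc f w)⁻¹ : ℝ) : ℂ) •
      mulOp w.1 (f.comp (gasketPath w.1 w.2) - ContinuousMap.const _ (cornerValue f w))‖ ≤ 1 := by
  refine (norm_smul _ _).trans_le ?_
  rw [Complex.norm_real, Real.norm_of_nonneg (inv_nonneg.mpr (cornerOsc_nonneg f w))]
  refine (mul_le_mul_of_nonneg_left (norm_mulOp_le _ _)
    (inv_nonneg.mpr (cornerOsc_nonneg f w))).trans ?_
  -- Covers zero oscillation too, where the inverse is 0.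
  exact inv_mul_le_one

/-- The normalized fluctuation of `π(f)` on each triangle. -/
def fluctuationOp (f : C(gasket, ℂ)) : GasketL2 →L[ℂ] GasketL2 :=
  blockDiag (fun w : Word => (((cornerOsc f w)⁻¹ : ℝ) : ℂ) •
    mulOp w.1 (f.comp (gasketPath w.1 w.2) - ContinuousMap.const _ (cornerValue f w)))
    (norm_fluctuation_le f)

lemma cornerOp_repr (f : C(gasket, ℂ)) (x : GasketL2) (p : Word × ℤ) :
    gasketBasis.repr ((cornerOp f ∘L gasketAbsPow gasketDim_nonneg) x) p
      = (cornerValue f p.1 * gasketWeight p) * gasketBasis.repr x p := by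
  rw [mul_assoc, ← gasketAbsPow_repr, gasketBasis_repr, gasketBasis_repr]
  change (fourierBasis (T := circ p.1.1)).repr
    (cornerValue f p.1 • (gasketAbsPow gasketDim_nonneg x) p.1) p.2 = _
  rw [map_smul]
  rfl

lemma oscOp_apply (f : C(gasket, ℂ)) (x : GasketL2) (w : Word) :
    oscOp f x w = (cornerOsc f w : ℂ) • gasketAbsPow gasketDim_nonneg x w := by
  apply (fourierBasis (T := circ w.1)).repr.injective
  ext k
  have h1 := gasketBasis_repr (oscOp f x) (w, k)
  have h2 := gasketBasis_repr (gasketAbsPow gasketDim_nonneg x) (w, k)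
  have h3 : gasketBasis.repr (oscOp f x) (w, k) = _ := diagOp_repr _ _ _ x (w, k)
  rw [map_smul]
  refine h1.symm.trans ?_
  change _ = (cornerOsc f w : ℂ) * _
  rw [h3, ← h2, gasketAbsPow_repr]
  push_cast
  ring

/-- On each triangle f is its corner value plus a deviation. The size of the deviation is moved into
the diagonal operator `oscOp`, leaving a contraction, so Ky Fan's inequality can handle this
non-diagonal remainder. -/
lemma gasketOp_eq (f : C(gasket, ℂ)) :
    gasketOp f = cornerOp f ∘L gasketAbsPow gasketDim_nonneg + fluctuationOp f ∘L oscOp f := by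
  refine ContinuousLinearMap.ext fun x => Subtype.ext (funext fun w => ?_)
  set y := gasketAbsPow gasketDim_nonneg x with hy
  have h1 : gasketOp f x w = mulOp w.1 (f.comp (gasketPath w.1 w.2)) (y w) := rfl
  have h2 : (cornerOp f ∘L gasketAbsPow gasketDim_nonneg + fluctuationOp f ∘L oscOp f) x w
      = cornerValue f w • y w + (((cornerOsc f w)⁻¹ : ℝ) : ℂ) •
        mulOp w.1 (f.comp (gasketPath w.1 w.2) - ContinuousMap.const _ (cornerValue f w))
          (oscOp f x w) := rfl
  rw [h1, h2, oscOp_apply, map_smul, smul_smul]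
  -- Where the oscillation is zero it cannot be divided out, but there f is constant on the triangle
  -- and the remainder vanishes.
  rcases eq_or_ne (cornerOsc f w) 0 with h0 | h0
  · have h3 : mulOp w.1 (f.comp (gasketPath w.1 w.2) - ContinuousMap.const _ (cornerValue f w)) = 0 :=
      norm_le_zero_iff.mp ((norm_mulOp_le _ _).trans_eq h0)
    have h4 := mulOp_sub_const w.1 (f.comp (gasketPath w.1 w.2)) (cornerValue f w) (y w)
    rw [h3, _root_.zero_apply] at h4
    rw [h3, _root_.zero_apply, smul_zero, add_zero]
    exact sub_eq_zero.mp h4.symm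
  · rw [← Complex.ofReal_mul, inv_mul_cancel₀ h0, Complex.ofReal_one, one_smul, mulOp_sub_const]
    abel

lemma norm_fluctuationOp_le (f : C(gasket, ℂ)) : ‖fluctuationOp f‖ ≤ 1 :=
  norm_blockDiag_le _ zero_le_one _

/-- A weight above t bounds both the word length and the frequency. -/
lemma finite_setOf_lt_weight {g : Word → ℝ} {K : ℝ} (hK : ∀ w, |g w| ≤ K) {t : ℝ} (ht : 0 < t) :
    {p : Word × ℤ | t < |g p.1 * gasketWeight p|}.Finite := by
  have hK0 : 0 ≤ K := (abs_nonneg _).trans (hK ⟨0, Fin.elim0⟩)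
  have h3 : Tendsto (fun k : ℤ => K * (3 * |2 * (k : ℝ) + 1| ^ (-gasketDim))) cofinite (𝓝 0) := by
    simpa using hasSum_odd_rpow.summable.tendsto_cofinite_zero.const_mul K
  have hfin : {k : ℤ | ¬ K * (3 * |2 * (k : ℝ) + 1| ^ (-gasketDim)) < t}.Finite :=
    h3.eventually_lt_const ht
  obtain ⟨L, hL⟩ := pow_unbounded_of_one_lt (K * 3 / t) (by norm_num : (1 : ℝ) < 3)
  refine ((shortWords L).finite_toSet.prod hfin).subset ?_
  intro p hp
  have hp' : t < |g p.1| * gasketWeight p := by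
    have := hp.out
    rwa [abs_mul, abs_of_nonneg (gasketWeight_nonneg p)] at this
  refine ⟨?_, ?_⟩
  · rw [Finset.mem_coe, mem_shortWords]
    by_contra! hlt
    have h1 : (3 : ℝ) ^ L ≤ 3 ^ p.1.1 := pow_le_pow_right₀ (by norm_num) hlt
    have h2 : t < K * (3 * (3 ^ p.1.1)⁻¹) := hp'.trans_le
      (mul_le_mul (hK _) (gasketWeight_le p) (gasketWeight_nonneg p) hK0)
    have h4 : (3 : ℝ) ^ p.1.1 * (3 ^ p.1.1)⁻¹ = 1 := mul_inv_cancel₀ (by positivity)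
    have h5 : 0 < ((3 : ℝ) ^ p.1.1)⁻¹ := by positivity
    have h6 : K * 3 < 3 ^ p.1.1 * t := by
      rw [div_lt_iff₀ ht] at hL
      exact hL.trans_le (mul_le_mul_of_nonneg_right h1 ht.le)
    nlinarith
  · simp only [Set.mem_ofPred_eq, not_lt]
    refine hp'.le.trans (mul_le_mul (hK _) ?_ (gasketWeight_nonneg p) hK0)
    rw [gasketWeight_eq]
    refine mul_le_of_le_one_left (by positivity) ?_
    exact inv_le_one_of_one_le₀ (one_le_pow₀ (by norm_num))

/-- The diagonal bound with threshold t = 1/N; the final 1 is N · t. -/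
lemma partialTrace_oscOp_le (f : C(gasket, ℂ)) {K : ℕ} (hK : 2 * ‖f‖ ≤ K) {N : ℕ} (hN : 1 ≤ N) :
    partialTrace (oscOp f) N ≤ 4 * zetaDim * ∑ l ∈ Finset.range (Nat.clog 3 (3 * K * N)),
      wordMean (fun w => max (cornerOsc f w) 0) l + 1 := by
  have hN0 : (0 : ℝ) < N := by exact_mod_cast hN
  have h := partialTrace_diagOp_le gasketBasis (fun p => cornerOsc f p.1 * gasketWeight p)
    (abs_mul_gasketWeight_le (abs_cornerOsc_le f))
    (fun t ht => finite_setOf_lt_weight (abs_cornerOsc_le f) ht)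
    (fun p => mul_nonneg (cornerOsc_nonneg f p.1) (gasketWeight_nonneg p))
    (inv_nonneg.mpr hN0.le)
    (sum_max_weight_le (cornerOsc f) (fun w => (cornerOsc_le f w).trans hK) hN) N
  rwa [mul_inv_cancel₀ hN0.ne'] at h

lemma gasketAbsPow_eq_diagOp : gasketAbsPow gasketDim_nonneg = diagOp gasketBasis
    (fun p => 1 * gasketWeight p) (abs_mul_gasketWeight_le (g := fun _ => 1) (K := 1) (by simp)) :=
  eq_diagOp_gasketBasis _ fun x p => by rw [gasketAbsPow_repr, one_mul]

lemma isCompactOperator_gasketAbsPow : IsCompactOperator (gasketAbsPow gasketDim_nonneg) := by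
  rw [gasketAbsPow_eq_diagOp]
  exact isCompactOperator_diagOp _ _ _ fun t ht =>
    finite_setOf_lt_weight (g := fun _ => 1) (K := 1) (by simp) ht

lemma isCompactOperator_gasketOp (f : C(gasket, ℂ)) : IsCompactOperator (gasketOp f) :=
  isCompactOperator_gasketAbsPow.clm_comp (gasketRep f)

lemma gasketAbsPow_isSelfAdjoint : IsSelfAdjoint (gasketAbsPow gasketDim_nonneg) := by
  rw [gasketAbsPow_eq_diagOp]
  exact (isPositive_diagOp _ _ _ fun p => by
    rw [one_mul]; exact gasketWeight_nonneg p).isSelfAdjoint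

lemma wordMean_one (l : ℕ) : wordMean (fun _ => max 1 0) l = 1 := by
  simp [wordMean]

lemma partialTrace_gasketAbsPow_le {N : ℕ} (hN : 1 ≤ N) :
    partialTrace (gasketAbsPow gasketDim_nonneg) N
      ≤ 4 * zetaDim * Nat.clog 3 (3 * N) + 1 := by
  have hN0 : (0 : ℝ) < N := by exact_mod_cast hN
  have h := partialTrace_diagOp_le gasketBasis (fun p => 1 * gasketWeight p)
    (abs_mul_gasketWeight_le (g := fun _ => 1) (K := 1) (by simp))
    (fun t ht => finite_setOf_lt_weight (g := fun _ => 1) (K := 1) (by simp) ht)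
    (fun p => by rw [one_mul]; exact gasketWeight_nonneg p)
    (inv_nonneg.mpr hN0.le)
    (sum_max_weight_le (fun _ => 1) (K := 1) (by simp) hN) N
  rw [mul_inv_cancel₀ hN0.ne'] at h
  rw [gasketAbsPow_eq_diagOp]
  simpa [wordMean_one, wordMean] using h

theorem memDixmierIdeal_gasketOp (f : C(gasket, ℂ)) : MemDixmierIdeal (gasketOp f) := by
  refine ⟨isCompactOperator_gasketOp f, ?_⟩
  have hlim := ((tendsto_clog_div_log (K := 3) (by norm_num)).const_mul (4 * zetaDim)).add
    (tendsto_log_natCast.const_div_atTop 1)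
  -- A convergent sequence is bounded; at N = 0, 1 the quotients are 0 by the conventions for log 0
  -- and division by 0.
  obtain ⟨C, hC⟩ := hlim.bddAbove_range
  refine ⟨‖gasketRep f‖ * C, fun N hN => ?_⟩
  have hlog : 0 < Real.log N := Real.log_pos (by exact_mod_cast hN)
  have h1 : partialTrace (gasketAbsPow gasketDim_nonneg) N ≤ C * Real.log N := by
    refine (partialTrace_gasketAbsPow_le (by omega)).trans ?_
    have : 4 * zetaDim * ((Nat.clog 3 (3 * N) : ℝ) / Real.log N) + 1 / Real.log N ≤ C :=
      hC ⟨N, rfl⟩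
    rw [← mul_div_assoc, ← add_div, div_le_iff₀ hlog] at this
    exact this
  calc partialTrace (gasketOp f) N ≤ ‖gasketRep f‖ * partialTrace (gasketAbsPow gasketDim_nonneg) N :=
        partialTrace_comp_le _ _ le_rfl N
    _ ≤ ‖gasketRep f‖ * (C * Real.log N) := by gcongr
    _ = _ := by ring

/-- The quadratic form on the optimal vectors splits: the corner part is diagonal, the fluctuation
is bounded by the trace of `oscOp`. Each of the two diagonal bounds with threshold 1/N leaves an
error 1. -/
lemma posRealTrace_gasketOp_le (f : C(gasket, ℂ)) {K : ℕ} (hK : 2 * ‖f‖ ≤ K) {N : ℕ}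
    (hN : 1 ≤ N) :
    posRealTrace (gasketOp f) N
      ≤ 4 * zetaDim * ∑ l ∈ Finset.range (Nat.clog 3 (3 * K * N)),
          wordMean (fun w => max (cornerValue f w).re 0) l +
        4 * zetaDim * ∑ l ∈ Finset.range (Nat.clog 3 (3 * K * N)),
          wordMean (fun w => max (cornerOsc f w) 0) l + 2 := by
  have hN0 : (0 : ℝ) < N := by exact_mod_cast hN
  obtain ⟨M, hM, e, he, h⟩ := exists_posRealTrace_le (gasketRep f) gasketAbsPow_isSelfAdjoint
    isCompactOperator_gasketAbsPow N
  change posRealTrace (gasketOp f) N ≤ ∑ i, (inner ℂ (e i) (gasketOp f (e i))).re at h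
  have h1 : ∑ i, (inner ℂ (e i) (gasketOp f (e i))).re
      = ∑ i, (inner ℂ (e i) ((cornerOp f ∘L gasketAbsPow gasketDim_nonneg) (e i))).re
        + ∑ i, (inner ℂ (e i) ((fluctuationOp f ∘L oscOp f) (e i))).re := by
    rw [← Finset.sum_add_distrib]
    refine Finset.sum_congr rfl fun i _ => ?_
    rw [gasketOp_eq, _root_.add_apply, inner_add_right, Complex.add_re]
  have hre : ∀ w, (cornerValue f w).re ≤ K := fun w =>
    ((Complex.re_le_norm _).trans (norm_cornerValue_le f w)).trans
      (by linarith [norm_nonneg f])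
  have h2 := sum_re_inner_diag_le gasketBasis _ _ (cornerOp_repr f) (inv_nonneg.mpr hN0.le)
    (V := 4 * zetaDim * ∑ l ∈ Finset.range (Nat.clog 3 (3 * K * N)),
      wordMean (fun w => max (cornerValue f w).re 0) l)
    (fun F => by
      simp only [Complex.re_mul_ofReal]
      exact sum_max_weight_le (fun w => (cornerValue f w).re) hre hN F) he
  have h3 : (M : ℝ) * (N : ℝ)⁻¹ ≤ 1 := by
    rw [← div_eq_mul_inv, div_le_one hN0]
    exact_mod_cast hM
  have h4 : ∑ i, (inner ℂ (e i) ((fluctuationOp f ∘L oscOp f) (e i))).re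
      ≤ partialTrace (oscOp f) N := by
    rw [← Complex.re_sum]
    refine (Complex.re_le_norm _).trans ((norm_sum_inner_le_partialTrace _ he).trans ?_)
    refine (partialTrace_comp_le _ _ (norm_fluctuationOp_le f) M).trans ?_
    rw [one_mul]
    exact partialTrace_mono _ hM
  have h5 := partialTrace_oscOp_le f hK hN
  linarith

lemma diagOp_basis {ι E : Type*} [NormedAddCommGroup E] [InnerProductSpace ℂ E]
    (b : HilbertBasis ι ℂ E) (a : ι → ℝ) {C : ℝ} (ha : ∀ k, |a k| ≤ C) (k : ι) :
    diagOp b a ha (b k) = (a k : ℂ) • b k := by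
  classical
  apply b.repr.injective
  ext j
  rw [diagOp_repr, map_smul, lp.coeFn_smul, Pi.smul_apply, smul_eq_mul, b.repr_apply_apply,
    orthonormal_iff_ite.mp b.orthonormal]
  split_ifs with h
  · rw [h]
  · simp

/-- A basis vector is an eigenvector of the corner part and of `oscOp`, and the fluctuation is a
contraction. -/
lemma le_re_inner_gasketBasis (f : C(gasket, ℂ)) (p : Word × ℤ) :
    ((cornerValue f p.1).re - cornerOsc f p.1) * gasketWeight p
      ≤ (inner ℂ (gasketBasis p) (gasketOp f (gasketBasis p))).re := by
  have hn : ‖gasketBasis p‖ = 1 := gasketBasis.orthonormal.1 p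
  have h1 : (inner ℂ (gasketBasis p)
      ((cornerOp f ∘L gasketAbsPow gasketDim_nonneg) (gasketBasis p)) : ℂ)
        = cornerValue f p.1 * gasketWeight p := by
    rw [← gasketBasis.repr_apply_apply, cornerOp_repr, gasketBasis.repr_apply_apply,
      inner_self_eq_norm_sq_to_K, hn]
    simp
  have h2 : ‖(inner ℂ (gasketBasis p) ((fluctuationOp f ∘L oscOp f) (gasketBasis p)) : ℂ)‖
      ≤ cornerOsc f p.1 * gasketWeight p := by
    refine (norm_inner_le_norm _ _).trans ?_
    rw [hn, one_mul, ContinuousLinearMap.comp_apply, oscOp, diagOp_basis, map_smul, norm_smul,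
      Complex.norm_real, Real.norm_of_nonneg
        (mul_nonneg (cornerOsc_nonneg f p.1) (gasketWeight_nonneg p))]
    refine mul_le_of_le_one_right
      (mul_nonneg (cornerOsc_nonneg f p.1) (gasketWeight_nonneg p)) ?_
    have := (fluctuationOp f).le_of_opNorm_le (norm_fluctuationOp_le f) (gasketBasis p)
    rwa [hn, one_mul] at this
  rw [gasketOp_eq, _root_.add_apply, inner_add_right, Complex.add_re, h1, Complex.re_mul_ofReal]
  have h3 := (abs_le.mp (Complex.abs_re_le_norm
    (inner ℂ (gasketBasis p) ((fluctuationOp f ∘L oscOp f) (gasketBasis p)) : ℂ))).1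
  linarith

lemma le_posRealTrace_gasketOp (f : C(gasket, ℂ)) (Z : Finset ℤ) (L : ℕ) {N : ℕ}
    (hN : 3 ^ L * Z.card ≤ N) :
    (∑ k ∈ Z, 3 * |2 * (k : ℝ) + 1| ^ (-gasketDim)) *
        ∑ l ∈ Finset.range L, wordMean (fun w => max (cornerValue f w).re 0 - cornerOsc f w) l
      ≤ posRealTrace (gasketOp f) N := by
  classical
  rw [← sum_shortWords_product (fun w => max (cornerValue f w).re 0 - cornerOsc f w)]
  -- Testing only where the corner value has positive real part produces the positive part; the
  -- discarded words contribute at most 0 to the left side.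
  set F := (shortWords L ×ˢ Z).filter fun p => 0 < (cornerValue f p.1).re with hF
  have hcard : F.card ≤ N := by
    refine (Finset.card_filter_le _ _).trans ?_
    rw [Finset.card_product]
    exact (Nat.mul_le_mul_right _ (card_shortWords_le L)).trans hN
  refine le_trans ?_ (sum_re_inner_le_posRealTrace (gasketOp f) gasketBasis.orthonormal F hcard)
  calc _ ≤ ∑ p ∈ shortWords L ×ˢ Z, if 0 < (cornerValue f p.1).re then
        ((cornerValue f p.1).re - cornerOsc f p.1) * gasketWeight p else 0 := by
        refine Finset.sum_le_sum fun p _ => ?_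
        split_ifs with h
        · rw [max_eq_left h.le]
        · rw [max_eq_right (not_lt.mp h), zero_sub, neg_mul, neg_nonpos]
          exact mul_nonneg (cornerOsc_nonneg f p.1) (gasketWeight_nonneg p)
    _ = ∑ p ∈ F, ((cornerValue f p.1).re - cornerOsc f p.1) * gasketWeight p :=
        (Finset.sum_filter _ _).symm
    _ ≤ _ := Finset.sum_le_sum fun p _ => le_re_inner_gasketBasis f p

/-- Upper and lower bounds have the same leading term: restricting to a finite set of frequencies Z
shifts the number of usable levels only by a bounded amount, while the frequency sum over Z comes
arbitrarily close to 4ζ(d). -/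
theorem tendsto_partialTrace_div_log (f : C(gasket, ℂ)) {I : ℝ}
    (hc : Tendsto (wordMean fun w => max (cornerValue f w).re 0) atTop (𝓝 I))
    (ho : Tendsto (wordMean (cornerOsc f)) atTop (𝓝 0)) :
    Tendsto (fun N : ℕ => posRealTrace (gasketOp f) N /
      Real.log N) atTop (𝓝 (4 * zetaDim * (I / Real.log 3))) := by
  have ho' : (fun w => max (cornerOsc f w) 0) = cornerOsc f :=
    funext fun w => max_eq_left (cornerOsc_nonneg f w)
  have h3 : 0 < Real.log 3 := Real.log_pos (by norm_num)
  rw [tendsto_order]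
  constructor
  · intro a ha
    have h1 : Tendsto (fun Z : Finset ℤ =>
        (∑ k ∈ Z, 3 * |2 * (k : ℝ) + 1| ^ (-gasketDim)) * (I / Real.log 3)) atTop
        (𝓝 (4 * zetaDim * (I / Real.log 3))) := Tendsto.mul_const _ hasSum_odd_rpow
    -- Z is fixed before N grows; 0 ∈ Z only ensures that Z is nonempty, as N is divided by its
    -- cardinality.
    obtain ⟨Z, hZ, hZ0⟩ := ((h1.eventually_const_lt ha).and (eventually_ge_atTop {0})).exists
    have hm : 1 ≤ Z.card := Finset.card_pos.mpr ⟨0, hZ0 (Finset.mem_singleton_self 0)⟩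
    have hG : Tendsto (wordMean fun w => max (cornerValue f w).re 0 - cornerOsc f w) atTop
        (𝓝 I) := by
      have := hc.sub ho
      rw [sub_zero] at this
      refine this.congr fun l => ?_
      simp only [wordMean, Finset.sum_sub_distrib, mul_sub]
    have h2 := (tendsto_sum_range_div_log hG (tendsto_nat_log_div_log hm)).const_mul
      (∑ k ∈ Z, 3 * |2 * (k : ℝ) + 1| ^ (-gasketDim))
    filter_upwards [h2.eventually_const_lt hZ, eventually_ge_atTop Z.card,
      tendsto_log_natCast.eventually_gt_atTop 0] with N hN hNZ hlog
    refine hN.trans_le ?_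
    rw [← mul_div_assoc]
    refine div_le_div_of_nonneg_right (le_posRealTrace_gasketOp f Z _ ?_) hlog.le
    have := Nat.pow_log_le_self 3 (Nat.div_pos hNZ hm).ne'
    exact (Nat.mul_le_mul_right _ this).trans (Nat.div_mul_le_self _ _)
  · intro a ha
    -- The extra 1 keeps K positive when f = 0.
    obtain ⟨K, hK⟩ := exists_nat_ge (2 * ‖f‖ + 1)
    have hK1 : 1 ≤ 3 * K := by
      have : (0 : ℝ) < K := by linarith [norm_nonneg f]
      have : 0 < K := by exact_mod_cast this
      omega
    have h1 := (tendsto_sum_range_div_log hc (tendsto_clog_div_log hK1)).const_mul (4 * zetaDim)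
    have h2 := (tendsto_sum_range_div_log ho (tendsto_clog_div_log hK1)).const_mul (4 * zetaDim)
    have h4 := (h1.add h2).add (tendsto_log_natCast.const_div_atTop 2)
    rw [zero_div, mul_zero, add_zero, add_zero] at h4
    filter_upwards [h4.eventually_lt_const ha, eventually_ge_atTop 1,
      tendsto_log_natCast.eventually_gt_atTop 0] with N hN hN1 hlog
    refine lt_of_le_of_lt ?_ hN
    rw [← mul_div_assoc, ← mul_div_assoc, ← add_div, ← add_div]
    have h5 := posRealTrace_gasketOp_le f (K := K) (by linarith) hN1
    rw [ho'] at h5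
    exact div_le_div_of_nonneg_right h5 hlog.le

end Decomposition

/-! ### Self-similarity of the gasket -/

section SelfSimilarity

/-- Displays the similarity ratio 2^{-n} and a dyadic translation; the translations are the partial
sums of the address series used for the coding map. -/
lemma wordMap_eq : ∀ (n : ℕ) (w : Fin n → Fin 3) (x : Plane),
    wordMap n w x = (2 ^ n : ℝ)⁻¹ • x + ∑ i : Fin n, (2 ^ ((i : ℕ) + 1) : ℝ)⁻¹ • vertex (w i)
  | 0, w, x => by simp [wordMap]
  | n + 1, w, x => by
    rw [wordMap, contraction, wordMap_eq n (Fin.tail w) x, Fin.sum_univ_succ, smul_add, smul_add,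
      smul_smul, Finset.smul_sum]
    have h1 : ∀ i : Fin n, (1 / 2 : ℝ) • (2 ^ ((i : ℕ) + 1) : ℝ)⁻¹ • vertex (Fin.tail w i)
        = (2 ^ (((Fin.succ i : Fin (n + 1)) : ℕ) + 1) : ℝ)⁻¹ • vertex (w i.succ) := fun i => by
      rw [smul_smul, Fin.val_succ, pow_succ 2 ((i : ℕ) + 1), mul_inv, mul_comm, one_div]
      rfl
    simp only [h1]
    rw [pow_succ, mul_inv, mul_comm, one_div]
    simp only [Fin.val_zero, zero_add, pow_one]
    abel

lemma dist_wordMap (n : ℕ) (w : Fin n → Fin 3) (x y : Plane) :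
    dist (wordMap n w x) (wordMap n w y) = (2 ^ n : ℝ)⁻¹ * dist x y := by
  rw [wordMap_eq, wordMap_eq, dist_add_right, dist_smul₀, Real.norm_of_nonneg (by positivity)]

/-- The boundary of the equilateral triangle. -/
def triangleBoundary : Set Plane :=
  {x | ∃ (i : Fin 3) (u : ℝ), 0 ≤ u ∧ u ≤ 1 ∧ x = (1 - u) • vertex i + u • vertex (i + 1)}

lemma range_triangleParam (n : ℕ) (w : Fin n → Fin 3) :
    Set.range (triangleParam n w) = wordMap n w '' triangleBoundary := by
  have hT := (circ_pos n).out
  apply Set.Subset.antisymm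
  · rintro _ ⟨t, rfl⟩
    have ht : t ∈ (fun x : ℝ => (x : Circ n)) '' Set.Ico 0 (0 + circ n) := by
      rw [AddCircle.coe_image_Ico_eq]; trivial
    obtain ⟨x, hx, rfl⟩ := ht
    rw [zero_add] at hx
    obtain ⟨s, hs⟩ : ∃ s, x = circ n / 3 * s := ⟨3 * x / circ n, by field_simp⟩
    have hs0 : 0 ≤ s := by
      by_contra! h
      nlinarith [hx.1]
    have hs3 : s ≤ 3 := by
      by_contra! h
      nlinarith [hx.2]
    simp only [hs]
    rcases le_total s 1 with h1 | h1
    · exact ⟨_, ⟨1, s, hs0, h1, rfl⟩, ((triangleParam_edges n w s hs0 h1).1).symm⟩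
    rcases le_total s 2 with h2 | h2
    · have h := (triangleParam_edges n w (s - 1) (by linarith) (by linarith)).2.1
      rw [add_sub_cancel] at h
      exact ⟨_, ⟨2, s - 1, by linarith, by linarith, rfl⟩, h.symm⟩
    · have h := (triangleParam_edges n w (s - 2) (by linarith) (by linarith)).2.2
      rw [add_sub_cancel] at h
      exact ⟨_, ⟨0, s - 2, by linarith, by linarith, rfl⟩, h.symm⟩
  · rintro _ ⟨_, ⟨i, u, h0, h1, rfl⟩, rfl⟩
    obtain ⟨a, b, c⟩ := triangleParam_edges n w u h0 h1
    fin_cases i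
    · exact ⟨_, c⟩
    · exact ⟨_, a⟩
    · exact ⟨_, b⟩

lemma gasket_eq : gasket = closure (⋃ (n : ℕ) (w : Fin n → Fin 3), wordMap n w '' triangleBoundary) := by
  simp only [gasket, range_triangleParam]

lemma image_wordMap_subset_gasket (n : ℕ) (w : Fin n → Fin 3) :
    wordMap n w '' triangleBoundary ⊆ gasket := by
  rw [gasket_eq]
  exact (Set.subset_iUnion₂ (s := fun (n : ℕ) (w : Fin n → Fin 3) =>
    wordMap n w '' triangleBoundary) n w).trans subset_closure

lemma triangleBoundary_subset_gasket : triangleBoundary ⊆ gasket := by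
  have h := image_wordMap_subset_gasket 0 Fin.elim0
  intro x hx
  exact h ⟨x, hx, rfl⟩

lemma contraction_mem_gasket (j : Fin 3) {x : Plane} (hx : x ∈ gasket) :
    contraction j x ∈ gasket := by
  have hcont : Continuous (contraction j) := by unfold contraction; fun_prop
  rw [gasket_eq] at hx
  have h := map_mem_closure hcont hx (t := gasket) (by
    intro y hy
    obtain ⟨n, w, e, he, rfl⟩ := Set.mem_iUnion₂.mp hy
    exact image_wordMap_subset_gasket (n + 1) (Fin.cons j w) ⟨e, he, by simp [wordMap]⟩)
  rwa [gasket, closure_closure] at h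

lemma wordMap_mem_gasket : ∀ (n : ℕ) (w : Fin n → Fin 3) {x : Plane}, x ∈ gasket →
    wordMap n w x ∈ gasket
  | 0, _, _, hx => hx
  | n + 1, w, _, hx => contraction_mem_gasket _ (wordMap_mem_gasket n (Fin.tail w) hx)

/-- Each half of an edge is the whole edge contracted towards the endpoint of that half. -/
lemma triangleBoundary_subset : ∀ x ∈ triangleBoundary,
    ∃ j, ∃ y ∈ triangleBoundary, contraction j y = x := by
  rintro _ ⟨i, u, h0, h1, rfl⟩
  rcases le_total u (1 / 2) with h | h
  · refine ⟨i, _, ⟨i, 2 * u, by linarith, by linarith, rfl⟩, ?_⟩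
    rw [contraction]; module
  · refine ⟨i + 1, _, ⟨i, 2 * u - 1, by linarith, by linarith, rfl⟩, ?_⟩
    rw [contraction]; module

lemma isCompact_gasket : IsCompact gasket := isCompact_iff_compactSpace.mpr inferInstance

/-- The right side is a finite union of compact sets, so it is enough to treat the dense union of
triangles. A nonempty word gives away its first letter; the empty word is covered by halving edges.
-/
lemma gasket_subset_iUnion : gasket ⊆ ⋃ j, contraction j '' gasket := by
  have hclosed : IsClosed (⋃ j, contraction j '' gasket) :=
    isClosed_iUnion_of_finite fun j =>
      (isCompact_gasket.image (by unfold contraction; fun_prop)).isClosed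
  conv_lhs => rw [gasket_eq]
  refine closure_minimal ?_ hclosed
  rintro _ hx
  obtain ⟨n, w, e, he, rfl⟩ := Set.mem_iUnion₂.mp hx
  cases n with
  | zero =>
    obtain ⟨j, y, hy, hyx⟩ := triangleBoundary_subset e he
    exact Set.mem_iUnion.mpr ⟨j, y, triangleBoundary_subset_gasket hy, hyx⟩
  | succ n =>
    exact Set.mem_iUnion.mpr ⟨w 0, _, image_wordMap_subset_gasket n (Fin.tail w) ⟨e, he, rfl⟩, rfl⟩

lemma exists_wordMap_eq : ∀ (n : ℕ) {x : Plane}, x ∈ gasket →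
    ∃ w : Fin n → Fin 3, ∃ y ∈ gasket, wordMap n w y = x
  | 0, x, hx => ⟨Fin.elim0, x, hx, rfl⟩
  | n + 1, x, hx => by
    obtain ⟨j, y, hy, rfl⟩ := Set.mem_iUnion.mp (gasket_subset_iUnion hx)
    obtain ⟨w, z, hz, rfl⟩ := exists_wordMap_eq n hy
    exact ⟨Fin.cons j w, z, hz, by simp [wordMap]⟩

/-- The similarity of the gasket onto its cell with address `w`. -/
def cellMap (n : ℕ) (w : Fin n → Fin 3) (x : gasket) : gasket :=
  ⟨wordMap n w x, wordMap_mem_gasket n w x.2⟩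

lemma iUnion_range_cellMap (n : ℕ) : ⋃ w, Set.range (cellMap n w) = Set.univ := by
  rw [Set.eq_univ_iff_forall]
  rintro ⟨x, hx⟩
  obtain ⟨w, y, hy, h⟩ := exists_wordMap_eq n hx
  exact Set.mem_iUnion.mpr ⟨w, ⟨y, hy⟩, Subtype.ext h⟩

lemma lipschitzWith_cellMap (n : ℕ) (w : Fin n → Fin 3) :
    LipschitzWith ((2 ^ n)⁻¹ : ℝ≥0) (cellMap n w) :=
  LipschitzWith.of_dist_le_mul fun x y => by
    rw [Subtype.dist_eq, Subtype.dist_eq]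
    exact (dist_wordMap n w x y).le.trans_eq (by push_cast; rfl)

end SelfSimilarity

/-! ### Finiteness of the Hausdorff measure -/

section HausdorffUpper

lemma inv_two_pow_rpow_gasketDim (n : ℕ) :
    (((2 ^ n)⁻¹ : ℝ≥0) : ℝ≥0∞) ^ gasketDim = ((3 ^ n : ℝ≥0∞))⁻¹ := by
  rw [← ENNReal.ofReal_coe_nnreal, ENNReal.ofReal_rpow_of_pos (by positivity)]
  push_cast
  rw [Real.inv_rpow (by positivity), ← Real.rpow_natCast, ← Real.rpow_mul (by norm_num), mul_comm,
    Real.rpow_mul (by norm_num), two_rpow_gasketDim, Real.rpow_natCast,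
    ENNReal.ofReal_inv_of_pos (by positivity), ENNReal.ofReal_pow (by norm_num)]
  norm_num

/-- The Hausdorff measure of dimension `log 3 / log 2` on the gasket. -/
abbrev gasketHausdorff : Measure gasket := Measure.hausdorffMeasure gasketDim

lemma gasketHausdorff_cell_le (n : ℕ) (w : Fin n → Fin 3) :
    gasketHausdorff (Set.range (cellMap n w)) ≤ (3 ^ n : ℝ≥0∞)⁻¹ * gasketHausdorff Set.univ := by
  rw [← Set.image_univ, ← inv_two_pow_rpow_gasketDim]
  exact (lipschitzWith_cellMap n w).hausdorffMeasure_image_le gasketDim_nonneg _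

lemma sum_words_const (n : ℕ) (c : ℝ≥0∞) :
    ∑ _w : Fin n → Fin 3, (3 ^ n : ℝ≥0∞)⁻¹ * c = c := by
  rw [Finset.sum_const, Finset.card_univ, Fintype.card_fun, Fintype.card_fin, Fintype.card_fin,
    nsmul_eq_mul, ← mul_assoc, Nat.cast_pow, Nat.cast_ofNat,
    ENNReal.mul_inv_cancel (by positivity) (by finiteness), one_mul]

/-- The 3^n cells have diameter at most 2^{-n} D, so their d-th powers sum to at most D^d for every
n. -/
lemma gasketHausdorff_univ_lt_top : gasketHausdorff Set.univ < ∞ := by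
  set D := Metric.ediam (Set.univ : Set gasket) with hD
  have hDtop : D ≠ ∞ := (isCompact_univ (X := gasket)).isBounded.ediam_ne_top
  have hdiam : ∀ n (w : Fin n → Fin 3),
      Metric.ediam (Set.range (cellMap n w)) ≤ (((2 ^ n)⁻¹ : ℝ≥0) : ℝ≥0∞) * D := fun n w => by
    rw [← Set.image_univ]
    exact (lipschitzWith_cellMap n w).ediam_image_le _
  have hr : Tendsto (fun n : ℕ => (((2 ^ n)⁻¹ : ℝ≥0) : ℝ≥0∞) * D) atTop (𝓝 0) := by
    have h1 : Tendsto (fun n : ℕ => (((2 ^ n)⁻¹ : ℝ≥0) : ℝ≥0∞)) atTop (𝓝 0) := by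
      have h2 : Tendsto (fun n : ℕ => ((2 ^ n)⁻¹ : ℝ≥0)) atTop (𝓝 0) := by
        simp only [← inv_pow]
        exact NNReal.tendsto_pow_atTop_nhds_zero_of_lt_one (by
          rw [← NNReal.coe_lt_coe]; norm_num)
      exact ENNReal.tendsto_coe.mpr h2
    simpa using ENNReal.Tendsto.mul_const h1 (Or.inr hDtop)
  have h := Measure.hausdorffMeasure_le_liminf_sum gasketDim (Set.univ : Set gasket) _ hr
    (fun n (w : Fin n → Fin 3) => Set.range (cellMap n w))
    (Eventually.of_forall hdiam)
    (Eventually.of_forall fun n => (iUnion_range_cellMap n).ge)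
  refine h.trans_lt (lt_of_le_of_lt (b := D ^ gasketDim) ?_
    (ENNReal.rpow_lt_top_of_nonneg gasketDim_nonneg hDtop))
  refine (liminf_le_liminf (v := fun _ => D ^ gasketDim)
    (Eventually.of_forall fun n => ?_)).trans_eq (liminf_const _)
  refine (Finset.sum_le_sum fun w _ =>
    ENNReal.rpow_le_rpow (hdiam n w) gasketDim_nonneg).trans_eq ?_
  rw [ENNReal.mul_rpow_of_nonneg _ _ gasketDim_nonneg, inv_two_pow_rpow_gasketDim, sum_words_const]

end HausdorffUpper

/-! ### Positivity of the Hausdorff measure by symbolic coding -/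

section Coding

/-- The `n`-th indicator of the symbol `c` in an infinite word. -/
def symbolBit (c : Fin 3) (ω : ℕ → Fin 3) (n : ℕ) : ℕ := if ω n = c then 1 else 0

lemma symbolBit_le_one (c : Fin 3) (ω : ℕ → Fin 3) (n : ℕ) : symbolBit c ω n ≤ 1 := by
  unfold symbolBit; split_ifs <;> norm_num

/-- The real number whose binary digits are the indicators of the symbol `c`. -/
def symbolSum (c : Fin 3) (ω : ℕ → Fin 3) : ℝ :=
  ∑' i : ℕ, (1 / 2 : ℝ) ^ (i + 1) * symbolBit c ω i

/-- The integer whose binary digits are the first `n` indicators of the symbol `c`. -/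
def symbolNum (c : Fin 3) (ω : ℕ → Fin 3) : ℕ → ℕ
  | 0 => 0
  | n + 1 => 2 * symbolNum c ω n + symbolBit c ω n

lemma hasSum_half_pow : HasSum (fun i : ℕ => (1 / 2 : ℝ) ^ (i + 1)) 1 := by
  have h := hasSum_geometric_two.mul_left (1 / 2 : ℝ)
  have e : (fun i : ℕ => (1 / 2 : ℝ) * (1 / 2 : ℝ) ^ i) = fun i => (1 / 2 : ℝ) ^ (i + 1) :=
    funext fun i => (pow_succ' _ _).symm
  rw [e] at h
  norm_num at h ⊢
  exact h

lemma norm_symbolTerm_le (c : Fin 3) (ω : ℕ → Fin 3) (i : ℕ) :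
    ‖(1 / 2 : ℝ) ^ (i + 1) * symbolBit c ω i‖ ≤ (1 / 2 : ℝ) ^ (i + 1) := by
  rw [Real.norm_of_nonneg (by positivity)]
  exact mul_le_of_le_one_right (by positivity) (by exact_mod_cast symbolBit_le_one c ω i)

lemma summable_symbolSum (c : Fin 3) (ω : ℕ → Fin 3) :
    Summable fun i : ℕ => (1 / 2 : ℝ) ^ (i + 1) * symbolBit c ω i :=
  Summable.of_norm_bounded hasSum_half_pow.summable (norm_symbolTerm_le c ω)

lemma symbolSum_nonneg (c : Fin 3) (ω : ℕ → Fin 3) : 0 ≤ symbolSum c ω :=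
  tsum_nonneg fun i => by positivity

lemma symbolSum_le_one (c : Fin 3) (ω : ℕ → Fin 3) : symbolSum c ω ≤ 1 :=
  hasSum_le (fun i => (le_abs_self _).trans (norm_symbolTerm_le c ω i))
    (summable_symbolSum c ω).hasSum hasSum_half_pow

lemma continuous_symbolSum (c : Fin 3) : Continuous (symbolSum c) := by
  refine continuous_tsum (fun i => ?_) hasSum_half_pow.summable fun i ω => norm_symbolTerm_le c ω i
  refine continuous_const.mul ?_
  exact (continuous_of_discreteTopology (f := fun a : Fin 3 => (((if a = c then 1 else 0 : ℕ)) : ℝ))).comp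
    (continuous_apply i)

lemma symbolSum_succ (c : Fin 3) (ω : ℕ → Fin 3) :
    symbolSum c ω = (symbolBit c ω 0 + symbolSum c fun i => ω (i + 1)) / 2 := by
  have h := (summable_symbolSum c ω).tsum_eq_zero_add
  rw [symbolSum, h, symbolSum]
  have e : (fun i : ℕ => (1 / 2 : ℝ) ^ (i + 1 + 1) * (symbolBit c ω (i + 1) : ℝ))
      = fun i => (1 / 2 : ℝ) * ((1 / 2 : ℝ) ^ (i + 1) * symbolBit c (fun i => ω (i + 1)) i) := by
    funext i
    rw [pow_succ' _ (i + 1), mul_assoc]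
    rfl
  rw [e, tsum_mul_left]
  ring

/-- Shifting the binary point by n places leaves an integer plus a remainder in [0, 1], so close
sums have close integers. -/
lemma symbolSum_eq (c : Fin 3) (ω : ℕ → Fin 3) (n : ℕ) :
    2 ^ n * symbolSum c ω = symbolNum c ω n + symbolSum c fun i => ω (i + n) := by
  induction n with
  | zero => simp [symbolNum]
  | succ n ih =>
    rw [pow_succ, mul_right_comm, ih, symbolSum_succ c fun i => ω (i + n), symbolNum]
    have h1 : symbolBit c (fun i => ω (i + n)) 0 = symbolBit c ω n := by simp [symbolBit]
    have h2 : (fun i => ω (i + 1 + n)) = fun i => ω (i + (n + 1)) :=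
      funext fun i => by rw [add_right_comm, add_assoc]
    rw [h1, h2]
    push_cast
    ring

/-- Parity recovers the last binary digit, and the indicators of 1 and 2 together determine the
letter. -/
lemma eq_of_symbolNum_eq {ω ω' : ℕ → Fin 3} : ∀ {n : ℕ}, symbolNum 1 ω n = symbolNum 1 ω' n →
    symbolNum 2 ω n = symbolNum 2 ω' n → ∀ i < n, ω i = ω' i
  | 0, _, _, i, hi => absurd hi (Nat.not_lt_zero i)
  | n + 1, h1, h2, i, hi => by
    simp only [symbolNum] at h1 h2
    have a1 := symbolBit_le_one 1 ω n
    have a2 := symbolBit_le_one 2 ω n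
    have b1 := symbolBit_le_one 1 ω' n
    have b2 := symbolBit_le_one 2 ω' n
    rcases Nat.lt_succ_iff_lt_or_eq.mp hi with h | rfl
    · exact eq_of_symbolNum_eq (by omega) (by omega) i h
    · have e1 : symbolBit 1 ω i = symbolBit 1 ω' i := by omega
      have e2 : symbolBit 2 ω i = symbolBit 2 ω' i := by omega
      unfold symbolBit at e1 e2
      generalize ω i = a at e1 e2 ⊢
      generalize ω' i = b at e1 e2 ⊢
      revert a b
      decide

/-- The point of the plane with a given infinite address. -/
def codePoint (ω : ℕ → Fin 3) : Plane :=
  symbolSum 1 ω • vertex 1 + symbolSum 2 ω • vertex 2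

lemma continuous_codePoint : Continuous codePoint :=
  ((continuous_symbolSum 1).smul continuous_const).add
    ((continuous_symbolSum 2).smul continuous_const)

lemma vertex_zero : vertex 0 = 0 := by
  ext i
  fin_cases i <;> simp [vertex]

lemma zero_mem_gasket : (0 : Plane) ∈ gasket :=
  triangleBoundary_subset_gasket ⟨0, 0, le_rfl, zero_le_one, by rw [vertex_zero]; simp⟩

/-- As vertex 0 is the origin, the point is Σ 2^{-(i+1)} v_{ω_i}, a limit of images of the origin
under finite word maps. -/
lemma codePoint_mem_gasket (ω : ℕ → Fin 3) : codePoint ω ∈ gasket := by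
  have h : HasSum (fun i : ℕ => (2 ^ (i + 1) : ℝ)⁻¹ • vertex (ω i)) (codePoint ω) := by
    have h0 := ((summable_symbolSum 1 ω).hasSum.smul_const (vertex 1)).add
      ((summable_symbolSum 2 ω).hasSum.smul_const (vertex 2))
    have e : (fun i : ℕ => ((1 / 2 : ℝ) ^ (i + 1) * symbolBit 1 ω i) • vertex 1
        + ((1 / 2 : ℝ) ^ (i + 1) * symbolBit 2 ω i) • vertex 2)
        = fun i : ℕ => (2 ^ (i + 1) : ℝ)⁻¹ • vertex (ω i) := by
      funext i
      rw [one_div, inv_pow]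
      unfold symbolBit
      generalize ω i = a
      fin_cases a <;> simp [vertex_zero]
    rw [e] at h0
    exact h0
  refine isClosed_closure.mem_of_tendsto h.tendsto_sum_nat (Eventually.of_forall fun n => ?_)
  have h1 := wordMap_mem_gasket n (fun i => ω i) zero_mem_gasket
  rw [wordMap_eq, smul_zero, zero_add,
    Fin.sum_univ_eq_sum_range (fun i => (2 ^ (i + 1) : ℝ)⁻¹ • vertex (ω i)) n] at h1
  exact h1

/-- In the basis v_1, v_2 the squared distance is (π/3)² · 4(a² + ab + b²). Since π > 3, it
dominates both a² and b². -/
lemma abs_symbolSum_sub_le (ω ω' : ℕ → Fin 3) :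
    |symbolSum 1 ω - symbolSum 1 ω'| ≤ dist (codePoint ω) (codePoint ω') ∧
    |symbolSum 2 ω - symbolSum 2 ω'| ≤ dist (codePoint ω) (codePoint ω') := by
  set a := symbolSum 1 ω - symbolSum 1 ω' with ha
  set b := symbolSum 2 ω - symbolSum 2 ω' with hb
  have hpi := Real.pi_gt_three
  have hs : 0 < Real.sqrt 3 := Real.sqrt_pos.mpr (by norm_num)
  have hs3 : Real.sqrt 3 ^ 2 = 3 := Real.sq_sqrt (by norm_num)
  have h0 : (codePoint ω - codePoint ω') 0 = Real.pi / 3 * (2 * a + b) := by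
    simp [codePoint, vertex, ha, hb]; ring
  have h1 : (codePoint ω - codePoint ω') 1 = Real.pi / Real.sqrt 3 * b := by
    simp [codePoint, vertex, hb]; ring
  have hd : dist (codePoint ω) (codePoint ω') ^ 2
      = (Real.pi / 3 * (2 * a + b)) ^ 2 + (Real.pi / Real.sqrt 3 * b) ^ 2 := by
    rw [dist_eq_norm, EuclideanSpace.norm_sq_eq, Fin.sum_univ_two, h0, h1, Real.norm_eq_abs,
      Real.norm_eq_abs, sq_abs, sq_abs]
  have hd2 : dist (codePoint ω) (codePoint ω') ^ 2
      = (Real.pi / 3) ^ 2 * ((2 * a + b) ^ 2 + 3 * b ^ 2) := by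
    rw [hd]
    have : (Real.pi / Real.sqrt 3 * b) ^ 2 = Real.pi ^ 2 / Real.sqrt 3 ^ 2 * b ^ 2 := by ring
    rw [this, hs3]; ring
  have hp : 1 ≤ (Real.pi / 3) ^ 2 := by nlinarith
  have key : (2 * a + b) ^ 2 + 3 * b ^ 2 ≤ dist (codePoint ω) (codePoint ω') ^ 2 := by
    rw [hd2]
    exact le_mul_of_one_le_left (by positivity) hp
  constructor <;> refine abs_le_of_sq_le_sq (key.trans' ?_) dist_nonneg
  · nlinarith [sq_nonneg (a + 2 * b)]
  · nlinarith [sq_nonneg (2 * a + b)]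

/-- The uniform Bernoulli measure on the space of infinite addresses. -/
def codeMeasure : Measure (ℕ → Fin 3) :=
  Measure.infinitePi fun _ : ℕ => (PMF.uniformOfFintype (Fin 3)).toMeasure

instance : IsProbabilityMeasure codeMeasure := by
  unfold codeMeasure; infer_instance

/-- The two integers fix the first n letters, hence a single cylinder. -/
lemma codeMeasure_symbolNum_le (n a b : ℕ) :
    codeMeasure {ω | symbolNum 1 ω n = a ∧ symbolNum 2 ω n = b} ≤ (3 ^ n : ℝ≥0∞)⁻¹ := by
  rcases Set.eq_empty_or_nonempty {ω | symbolNum 1 ω n = a ∧ symbolNum 2 ω n = b} with h | ⟨ω₀, h₀⟩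
  · rw [h, measure_empty]; exact zero_le
  · have hsub : {ω | symbolNum 1 ω n = a ∧ symbolNum 2 ω n = b}
        ⊆ Set.pi (Finset.range n : Set ℕ) fun i => {ω₀ i} := by
      intro ω hω i hi
      exact eq_of_symbolNum_eq (hω.1.trans h₀.1.symm) (hω.2.trans h₀.2.symm) i
        (Finset.mem_range.mp hi)
    refine (measure_mono hsub).trans_eq ?_
    rw [codeMeasure, Measure.infinitePi_pi _ fun i _ => measurableSet_singleton _]
    simp only [PMF.toMeasure_apply_singleton _ _ (measurableSet_singleton _),
      PMF.uniformOfFintype_apply, Fintype.card_fin, Finset.prod_const, Finset.card_range]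
    rw [ENNReal.inv_pow]
    norm_num

lemma codeMeasure_preimage_le {s : Set Plane} {n : ℕ}
    (hs : ∀ x ∈ s, ∀ y ∈ s, dist x y ≤ (2 ^ n : ℝ)⁻¹) :
    codeMeasure (codePoint ⁻¹' s) ≤ 25 * (3 ^ n : ℝ≥0∞)⁻¹ := by
  rcases Set.eq_empty_or_nonempty (codePoint ⁻¹' s) with h | ⟨ω₀, h₀⟩
  · rw [h, measure_empty]; exact zero_le
  let I : Fin 3 → Finset ℕ := fun c =>
    -- Scaled sums differ by at most 1 and remainders lie in [0, 1], so the integers differ by at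
    -- most 2: five values per coordinate, 25 pairs.
    Finset.Icc (symbolNum c ω₀ n - 2) (symbolNum c ω₀ n + 2)
  have hI : ∀ c, (I c).card ≤ 5 := fun c => by
    simp only [I, Nat.card_Icc]; omega
  have hmem : ∀ ω ∈ codePoint ⁻¹' s, ∀ c,
      |symbolSum c ω - symbolSum c ω₀| ≤ dist (codePoint ω) (codePoint ω₀) →
      symbolNum c ω n ∈ I c := by
    intro ω hω c hc
    have h1 := hc.trans (hs _ hω _ h₀)
    have e1 := symbolSum_eq c ω n
    have e2 := symbolSum_eq c ω₀ n
    have h2 : |2 ^ n * symbolSum c ω - 2 ^ n * symbolSum c ω₀| ≤ 1 := by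
      rw [← mul_sub, abs_mul, abs_of_pos (by positivity : (0 : ℝ) < 2 ^ n)]
      calc _ ≤ (2 : ℝ) ^ n * (2 ^ n)⁻¹ := by gcongr
        _ = 1 := mul_inv_cancel₀ (by positivity)
    rw [e1, e2, abs_le] at h2
    have b1 := symbolSum_nonneg c fun i => ω (i + n)
    have b2 := symbolSum_le_one c fun i => ω (i + n)
    have b3 := symbolSum_nonneg c fun i => ω₀ (i + n)
    have b4 := symbolSum_le_one c fun i => ω₀ (i + n)
    have c1 : (symbolNum c ω n : ℝ) ≤ symbolNum c ω₀ n + 2 := by linarith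
    have c2 : (symbolNum c ω₀ n : ℝ) ≤ symbolNum c ω n + 2 := by linarith
    have c1' : symbolNum c ω n ≤ symbolNum c ω₀ n + 2 := by exact_mod_cast c1
    have c2' : symbolNum c ω₀ n ≤ symbolNum c ω n + 2 := by exact_mod_cast c2
    exact Finset.mem_Icc.mpr ⟨by omega, c1'⟩
  have hsub : codePoint ⁻¹' s ⊆ ⋃ p ∈ I 1 ×ˢ I 2,
      {ω | symbolNum 1 ω n = p.1 ∧ symbolNum 2 ω n = p.2} := by
    intro ω hω
    refine Set.mem_iUnion₂.mpr ⟨(symbolNum 1 ω n, symbolNum 2 ω n), Finset.mem_product.mpr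
      ⟨hmem ω hω 1 (abs_symbolSum_sub_le _ _).1, hmem ω hω 2 (abs_symbolSum_sub_le _ _).2⟩,
      rfl, rfl⟩
  calc codeMeasure (codePoint ⁻¹' s)
      ≤ ∑ p ∈ I 1 ×ˢ I 2, codeMeasure {ω | symbolNum 1 ω n = p.1 ∧ symbolNum 2 ω n = p.2} :=
        (measure_mono hsub).trans (measure_biUnion_finset_le _ _)
    _ ≤ ∑ _p ∈ I 1 ×ˢ I 2, (3 ^ n : ℝ≥0∞)⁻¹ :=
        Finset.sum_le_sum fun p _ => codeMeasure_symbolNum_le n p.1 p.2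
    _ ≤ 25 * (3 ^ n : ℝ≥0∞)⁻¹ := by
        rw [Finset.sum_const, Finset.card_product, nsmul_eq_mul]
        gcongr
        exact_mod_cast Nat.mul_le_mul (hI 1) (hI 2)

/-- For 2^{-(n+1)} < diam s ≤ 2^{-n} the bound 25 · 3^{-n} equals 75 · 3^{-(n+1)}. For diameter 0
the bound holds for every n, so the mass is 0. -/
lemma codeMeasure_preimage_le_ediam {s : Set Plane} (hs : Metric.ediam s ≤ 1) :
    codeMeasure (codePoint ⁻¹' s) ≤ 75 * Metric.ediam s ^ gasketDim := by
  have hfin : Metric.ediam s ≠ ∞ := ne_top_of_le_ne_top ENNReal.one_ne_top hs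
  have hdist : ∀ n : ℕ, (Metric.ediam s).toReal ≤ (2 ^ n : ℝ)⁻¹ →
      codeMeasure (codePoint ⁻¹' s) ≤ 25 * (3 ^ n : ℝ≥0∞)⁻¹ := fun n hn =>
    codeMeasure_preimage_le fun x hx y hy => by
      refine le_trans ?_ hn
      rw [dist_edist]
      exact ENNReal.toReal_mono hfin (Metric.edist_le_ediam_of_mem hx hy)
  set r := (Metric.ediam s).toReal with hr
  rcases (ENNReal.toReal_nonneg : 0 ≤ r).eq_or_lt with h0 | h0
  · have h1 : ∀ n : ℕ, codeMeasure (codePoint ⁻¹' s) ≤ 25 * (3 ^ n : ℝ≥0∞)⁻¹ := fun n =>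
      hdist n (h0.symm.trans_le (by positivity))
    have h2 : Tendsto (fun n : ℕ => 25 * (3 ^ n : ℝ≥0∞)⁻¹) atTop (𝓝 (25 * 0)) := by
      refine ENNReal.Tendsto.const_mul ?_ (Or.inr (by norm_num))
      simp only [ENNReal.inv_pow]
      exact ENNReal.tendsto_pow_atTop_nhds_zero_of_lt_one
        (ENNReal.inv_lt_one.mpr (by norm_num))
    rw [mul_zero] at h2
    exact (ge_of_tendsto h2 (Eventually.of_forall h1)).trans zero_le
  · have hr1 : r ≤ 1 := by
      have := ENNReal.toReal_mono ENNReal.one_ne_top hs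
      simpa using this
    obtain ⟨n, hn1, hn2⟩ := exists_nat_pow_near_of_lt_one h0 hr1 (by norm_num : (0 : ℝ) < 1 / 2)
      (by norm_num)
    rw [one_div, inv_pow] at hn1 hn2
    refine (hdist n hn2).trans ?_
    have h3 : (((2 ^ (n + 1))⁻¹ : ℝ≥0) : ℝ≥0∞) ≤ Metric.ediam s := by
      rw [← ENNReal.ofReal_coe_nnreal, ← ENNReal.ofReal_toReal hfin]
      refine ENNReal.ofReal_le_ofReal ?_
      push_cast
      exact hn1.le
    calc 25 * (3 ^ n : ℝ≥0∞)⁻¹ = 75 * (3 ^ (n + 1) : ℝ≥0∞)⁻¹ := by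
          rw [pow_succ, ENNReal.mul_inv (Or.inl (by positivity)) (Or.inl (by finiteness)),
            mul_comm (3 ^ n : ℝ≥0∞)⁻¹, ← mul_assoc]
          congr 1
          rw [← div_eq_mul_inv, ENNReal.eq_div_iff (by norm_num) (by norm_num)]
          norm_num
      _ ≤ 75 * Metric.ediam s ^ gasketDim := by
          rw [← inv_two_pow_rpow_gasketDim]
          gcongr
          exact gasketDim_nonneg

/-- Mass distribution principle: 1/75 of the image of the Bernoulli measure is dominated by the
Hausdorff measure and lives on the gasket. -/
lemma gasketHausdorff_univ_pos : 0 < gasketHausdorff Set.univ := by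
  have h1 : (75 : ℝ≥0∞)⁻¹ • codeMeasure.map codePoint ≤ Measure.hausdorffMeasure gasketDim := by
    refine Measure.le_hausdorffMeasure gasketDim _ 1 one_pos fun s hs => ?_
    calc ((75 : ℝ≥0∞)⁻¹ • codeMeasure.map codePoint) s
        -- The closure is measurable and has the same diameter.
        ≤ ((75 : ℝ≥0∞)⁻¹ • codeMeasure.map codePoint) (closure s) := measure_mono subset_closure
      _ = (75 : ℝ≥0∞)⁻¹ * codeMeasure (codePoint ⁻¹' closure s) := by
          rw [Measure.smul_apply, smul_eq_mul,
            Measure.map_apply continuous_codePoint.measurable isClosed_closure.measurableSet]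
      _ ≤ (75 : ℝ≥0∞)⁻¹ * (75 * Metric.ediam s ^ gasketDim) := by
          have := codeMeasure_preimage_le_ediam (s := closure s) (by rwa [Metric.ediam_closure])
          rw [Metric.ediam_closure] at this
          gcongr
      _ = Metric.ediam s ^ gasketDim := by
          rw [← mul_assoc, ENNReal.inv_mul_cancel (by norm_num) (by norm_num), one_mul]
  have h2 := h1 gasket
  rw [Measure.smul_apply, smul_eq_mul, Measure.map_apply continuous_codePoint.measurable
    isCompact_gasket.isClosed.measurableSet, Set.preimage_eq_univ_iff.mpr
    (by rintro _ ⟨ω, rfl⟩; exact codePoint_mem_gasket ω), measure_univ, mul_one] at h2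
  have h3 := (isometry_subtype_coe (s := gasket)).hausdorffMeasure_image
    (d := gasketDim) (Or.inl gasketDim_nonneg) Set.univ
  rw [Set.image_univ, Subtype.range_coe] at h3
  rw [gasketHausdorff, ← h3]
  exact lt_of_lt_of_le (ENNReal.inv_pos.mpr (by norm_num)) h2

end Coding

/-! ### Cell masses and Riemann sums -/

section Integration

instance isProbabilityMeasure_hausdorffProb : IsProbabilityMeasure hausdorffProb := by
  refine ⟨?_⟩
  rw [hausdorffProb, Measure.smul_apply, smul_eq_mul]
  exact ENNReal.inv_mul_cancel gasketHausdorff_univ_pos.ne' gasketHausdorff_univ_lt_top.ne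

lemma hausdorffProb_cell_le (n : ℕ) (w : Fin n → Fin 3) :
    hausdorffProb (Set.range (cellMap n w)) ≤ (3 ^ n : ℝ≥0∞)⁻¹ := by
  rw [hausdorffProb, Measure.smul_apply, smul_eq_mul]
  refine (mul_le_mul_right (gasketHausdorff_cell_le n w) _).trans_eq ?_
  rw [mul_left_comm, ENNReal.inv_mul_cancel gasketHausdorff_univ_pos.ne'
    gasketHausdorff_univ_lt_top.ne, mul_one]

/-- Mass counting replaces a study of overlaps: the cells cover, so the sum dominates the measure,
and its total mass is at most 3^n · 3^{-n} = 1. -/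
lemma sum_restrict_cell (n : ℕ) :
    ∑ w, hausdorffProb.restrict (Set.range (cellMap n w)) = hausdorffProb := by
  have hle : hausdorffProb ≤ ∑ w, hausdorffProb.restrict (Set.range (cellMap n w)) := by
    refine Measure.le_iff.mpr fun s hs => ?_
    rw [Measure.finsetSum_apply]
    calc hausdorffProb s = hausdorffProb (⋃ w, s ∩ Set.range (cellMap n w)) := by
          rw [← Set.inter_iUnion, iUnion_range_cellMap, Set.inter_univ]
      _ ≤ ∑ w, hausdorffProb (s ∩ Set.range (cellMap n w)) := measure_iUnion_fintype_le _ _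
      _ = _ := Finset.sum_congr rfl fun w _ => (Measure.restrict_apply hs).symm
  refine (Measure.eq_of_le_of_measure_univ_eq hle (le_antisymm (hle _) ?_)).symm
  rw [Measure.finsetSum_apply, measure_univ, ← sum_words_const n 1]
  refine Finset.sum_le_sum fun w _ => ?_
  rw [Measure.restrict_apply_univ, mul_one]
  exact hausdorffProb_cell_le n w

lemma hausdorffProb_real_cell (n : ℕ) (w : Fin n → Fin 3) :
    hausdorffProb.real (Set.range (cellMap n w)) = (3 ^ n : ℝ)⁻¹ := by
  have h1 : ∀ w ∈ (Finset.univ : Finset (Fin n → Fin 3)),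
      hausdorffProb.real (Set.range (cellMap n w)) ≤ (3 ^ n : ℝ)⁻¹ := fun w _ => by
    have := ENNReal.toReal_mono (by finiteness) (hausdorffProb_cell_le n w)
    rwa [ENNReal.toReal_inv, ENNReal.toReal_pow, ENNReal.toReal_ofNat] at this
  have h2 : ∑ w, hausdorffProb.real (Set.range (cellMap n w)) = 1 := by
    have h3 := congrArg (fun μ : Measure gasket => (μ Set.univ).toReal) (sum_restrict_cell n)
    simp only [Measure.finsetSum_apply, Measure.restrict_apply_univ, measure_univ,
      ENNReal.toReal_one] at h3
    rw [ENNReal.toReal_sum fun w _ => measure_ne_top _ _] at h3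
    exact h3
  have h4 : ∑ _w : Fin n → Fin 3, (3 ^ n : ℝ)⁻¹ = 1 := by
    simp
  exact (Finset.sum_eq_sum_iff_of_le h1).mp (h2.trans h4.symm) w (Finset.mem_univ w)

lemma gasketPath_mem_cell (n : ℕ) (w : Fin n → Fin 3) (t : Circ n) :
    gasketPath n w t ∈ Set.range (cellMap n w) := by
  obtain ⟨e, he, h⟩ := (range_triangleParam n w).subset ⟨t, rfl⟩
  exact ⟨⟨e, triangleBoundary_subset_gasket he⟩, Subtype.ext h⟩

lemma eventually_dist_le_of_mem_cell {E : Type*} [PseudoMetricSpace E] (f : C(gasket, E)) {ε : ℝ}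
    (hε : 0 < ε) : ∀ᶠ n : ℕ in atTop, ∀ w : Fin n → Fin 3, ∀ x ∈ Set.range (cellMap n w),
      ∀ y ∈ Set.range (cellMap n w), dist (f x) (f y) ≤ ε := by
  have huc := CompactSpace.uniformContinuous_of_continuous f.continuous
  obtain ⟨δ, hδ, h⟩ := Metric.uniformContinuous_iff.mp huc ε hε
  have hb : Bornology.IsBounded (Set.univ : Set gasket) := isCompact_univ.isBounded
  have hlim : Tendsto (fun n : ℕ => (2 ^ n : ℝ)⁻¹ * Metric.diam (Set.univ : Set gasket)) atTop
      (𝓝 0) := by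
    have := (tendsto_pow_atTop_nhds_zero_of_lt_one (r := (2⁻¹ : ℝ)) (by norm_num)
      (by norm_num)).mul_const (Metric.diam (Set.univ : Set gasket))
    simpa only [inv_pow, zero_mul] using this
  filter_upwards [hlim.eventually_lt_const hδ] with n hn
  rintro w _ ⟨x, rfl⟩ _ ⟨y, rfl⟩
  refine (h (lt_of_le_of_lt ?_ hn)).le
  refine ((lipschitzWith_cellMap n w).dist_le_mul x y).trans ?_
  push_cast
  gcongr
  exact Metric.dist_le_diam_of_mem hb (Set.mem_univ x) (Set.mem_univ y)

/-- The word mean is a Riemann sum over cells of mass 3^{-n}, sampled at a corner of each. -/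
lemma abs_wordMean_sub_integral_le (g : C(gasket, ℝ)) {ε : ℝ} {n : ℕ}
    (h : ∀ w : Fin n → Fin 3, ∀ x ∈ Set.range (cellMap n w), ∀ y ∈ Set.range (cellMap n w),
      dist (g x) (g y) ≤ ε) :
    |wordMean (fun w => g (gasketPath w.1 w.2 0)) n - ∫ x, g x ∂hausdorffProb| ≤ ε := by
  have hint : Integrable g hausdorffProb :=
    g.continuous.integrable_of_hasCompactSupport (HasCompactSupport.of_compactSpace _)
  have hsum : ∫ x, g x ∂hausdorffProb
      = ∑ w, ∫ x in Set.range (cellMap n w), g x ∂hausdorffProb := by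
    conv_lhs => rw [← sum_restrict_cell n]
    exact integral_finsetSum_measure fun w _ => hint.restrict
  rw [hsum, wordMean, Finset.mul_sum, ← Finset.sum_sub_distrib]
  refine (Finset.abs_sum_le_sum_abs _ _).trans ?_
  have hterm : ∀ w : Fin n → Fin 3, |(3 ^ n : ℝ)⁻¹ * g (gasketPath n w 0)
      - ∫ x in Set.range (cellMap n w), g x ∂hausdorffProb| ≤ ε * (3 ^ n : ℝ)⁻¹ := fun w => by
    have h1 : (3 ^ n : ℝ)⁻¹ * g (gasketPath n w 0)
        = ∫ _x in Set.range (cellMap n w), g (gasketPath n w 0) ∂hausdorffProb := by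
      rw [setIntegral_const, hausdorffProb_real_cell, smul_eq_mul]
    rw [h1, ← integral_sub (integrable_const _) hint.restrict, ← Real.norm_eq_abs,
      ← hausdorffProb_real_cell n w]
    refine norm_setIntegral_le_of_norm_le_const (measure_lt_top _ _) fun x hx => ?_
    rw [← dist_eq_norm]
    exact h w _ (gasketPath_mem_cell n w 0) x hx
  refine (Finset.sum_le_sum fun w _ => hterm w).trans_eq ?_
  simp only [Finset.sum_const, Finset.card_univ, Fintype.card_fun, Fintype.card_fin, nsmul_eq_mul,
    Nat.cast_pow, Nat.cast_ofNat]
  rw [mul_left_comm, mul_inv_cancel₀ (by positivity), mul_one]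

lemma tendsto_wordMean_integral (g : C(gasket, ℝ)) :
    Tendsto (wordMean fun w => g (gasketPath w.1 w.2 0)) atTop
      (𝓝 (∫ x, g x ∂hausdorffProb)) := by
  rw [Metric.tendsto_nhds]
  intro ε hε
  filter_upwards [eventually_dist_le_of_mem_cell g (half_pos hε)] with n hn
  exact (abs_wordMean_sub_integral_le g hn).trans_lt (half_lt_self hε)

lemma tendsto_wordMean_cornerOsc (f : C(gasket, ℂ)) :
    Tendsto (wordMean (cornerOsc f)) atTop (𝓝 0) := by
  rw [Metric.tendsto_nhds]
  intro ε hε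
  filter_upwards [eventually_dist_le_of_mem_cell f (half_pos hε)] with n hn
  rw [Real.dist_eq, sub_zero, abs_of_nonneg (wordMean_nonneg (cornerOsc_nonneg f) n)]
  have h1 : ∀ w : Fin n → Fin 3, cornerOsc f ⟨n, w⟩ ≤ ε / 2 := fun w => by
    refine (ContinuousMap.norm_le _ (half_pos hε).le).mpr fun t => ?_
    exact (dist_eq_norm _ _).symm.trans_le
      (hn w _ (gasketPath_mem_cell n w t) _ (gasketPath_mem_cell n w 0))
  calc wordMean (cornerOsc f) n ≤ (3 ^ n)⁻¹ * ∑ _w : Fin n → Fin 3, ε / 2 :=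
        mul_le_mul_of_nonneg_left (Finset.sum_le_sum fun w _ => h1 w) (by positivity)
    _ = ε / 2 := by simp
    _ < ε := half_lt_self hε

end Integration

/-! ### The Dixmier trace when the limits exist -/

section Trace

variable {H : Type*} [NormedAddCommGroup H] [InnerProductSpace ℂ H]

lemma DixmierLimit.lim_eq_of_tendsto (ω : DixmierLimit) {a : ℕ → ℝ} {L : ℝ}
    (h : Tendsto a atTop (𝓝 L)) : ω.lim a = L := by
  have hb : Memℓp a ∞ := memℓp_infty h.norm.bddAbove_range
  rw [DixmierLimit.lim, dif_pos hb]
  exact ω.eq_of_tendsto _ L h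

lemma dixmierTracePos_eq_of_tendsto (ω : DixmierLimit) {T : H →L[ℂ] H} {L : ℝ}
    (h : Tendsto (fun N : ℕ => partialTrace T N / Real.log N) atTop (𝓝 L)) :
    dixmierTracePos ω T = L :=
  -- The entry with index m belongs to N = m + 1, hence the shift.
  ω.lim_eq_of_tendsto ((tendsto_add_atTop_iff_nat 1).mpr h)

variable [CompleteSpace H]

lemma negPart_realPart (T : H →L[ℂ] H) :
    (realPart T : H →L[ℂ] H)⁻ = (realPart (-T) : H →L[ℂ] H)⁺ := by
  rw [map_neg, NegMemClass.coe_neg, CFC.posPart_neg]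

lemma imaginaryPart_eq_realPart (T : H →L[ℂ] H) :
    imaginaryPart T = realPart ((-Complex.I) • T) := by
  rw [neg_smul, map_neg, realPart_I_smul, neg_neg]

/-- All four parts of T are positive parts of real parts of multiples cT, because S⁻ = (-S)⁺ and Im
T = Re(-iT). Thus additivity of the trace is never needed. -/
lemma dixmierTrace_eq_of_tendsto (ω : DixmierLimit) {T : H →L[ℂ] H} {L : ℂ → ℝ}
    (h : ∀ c : ℂ, Tendsto (fun N : ℕ => posRealTrace (c • T) N / Real.log N) atTop (𝓝 (L c))) :
    dixmierTrace ω T = ((L 1 - L (-1) : ℝ) : ℂ)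
      + Complex.I * ((L (-Complex.I) - L Complex.I : ℝ) : ℂ) := by
  have h1 : ∀ c : ℂ, dixmierTracePos ω ((realPart (c • T) : H →L[ℂ] H)⁺) = L c := fun c =>
    dixmierTracePos_eq_of_tendsto ω (h c)
  have e1 := h1 1
  have e2 := h1 (-1)
  have e3 := h1 (-Complex.I)
  have e4 := h1 Complex.I
  rw [one_smul] at e1
  rw [neg_smul, one_smul, ← negPart_realPart] at e2
  rw [← imaginaryPart_eq_realPart] at e3
  have e5 : Complex.I • T = -((-Complex.I) • T) := by rw [neg_smul, neg_neg]
  rw [e5, ← negPart_realPart, ← imaginaryPart_eq_realPart] at e4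
  rw [dixmierTrace, e1, e2, e3, e4]

end Trace

/-! ### Computation of the functional -/

section GasketTrace

/-- Reduces the four multiples of the operator to a single asymptotic statement for all continuous
functions. -/
lemma gasketOp_smul (c : ℂ) (f : C(gasket, ℂ)) : gasketOp (c • f) = c • gasketOp f := by
  refine ContinuousLinearMap.ext fun x => Subtype.ext (funext fun w => ?_)
  set y := gasketAbsPow gasketDim_nonneg x w
  change mulOp w.1 ((c • f).comp (gasketPath w.1 w.2)) y
    = c • mulOp w.1 (f.comp (gasketPath w.1 w.2)) y
  apply Lp.ext
  filter_upwards [mulOp_ae w.1 ((c • f).comp (gasketPath w.1 w.2)) y,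
    mulOp_ae w.1 (f.comp (gasketPath w.1 w.2)) y,
    Lp.coeFn_smul c (mulOp w.1 (f.comp (gasketPath w.1 w.2)) y)] with t h1 h2 h3
  rw [h1, h3, Pi.smul_apply, h2, smul_eq_mul, ← mul_assoc]
  rfl

lemma tendsto_posRealTrace_gasketOp (f : C(gasket, ℂ)) :
    Tendsto (fun N : ℕ => posRealTrace (gasketOp f) N / Real.log N) atTop
      (𝓝 (4 * zetaDim * ((∫ x, max (f x).re 0 ∂hausdorffProb) / Real.log 3))) := by
  let g : C(gasket, ℝ) := ⟨fun x => max (f x).re 0, by fun_prop⟩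
  exact tendsto_partialTrace_div_log f (tendsto_wordMean_integral g) (tendsto_wordMean_cornerOsc f)

lemma integrable_continuousMap (f : C(gasket, ℂ)) : Integrable f hausdorffProb :=
  f.continuous.integrable_of_hasCompactSupport (HasCompactSupport.of_compactSpace _)

lemma integral_posPart_sub (f : C(gasket, ℂ)) :
    ∫ x, max (f x).re 0 ∂hausdorffProb - ∫ x, max (-(f x).re) 0 ∂hausdorffProb
      = (∫ x, f x ∂hausdorffProb).re := by
  have hre : Integrable (fun x => (f x).re) hausdorffProb := (integrable_continuousMap f).re
  have hneg : Integrable (fun x => max (-(f x).re) 0) hausdorffProb := hre.neg.pos_part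
  rw [← integral_sub hre.pos_part hneg]
  have h : ∀ x, max (f x).re 0 - max (-(f x).re) 0 = (f x).re := fun x => by
    rcases le_total (f x).re 0 with h0 | h0
    · rw [max_eq_right h0, max_eq_left (neg_nonneg.mpr h0)]; ring
    · rw [max_eq_left h0, max_eq_right (neg_nonpos.mpr h0)]; ring
  simp only [h]
  exact integral_re (integrable_continuousMap f)

theorem tau_eq (ω : DixmierLimit) (f : C(gasket, ℂ)) :
    tau ω f = ((4 / Real.log 3 : ℝ) : ℂ) * (zetaDim : ℂ) * ∫ x, f x ∂hausdorffProb := by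
  have h := dixmierTrace_eq_of_tendsto ω (T := gasketOp f)
    (L := fun c => 4 * zetaDim * ((∫ x, max ((c • f) x).re 0 ∂hausdorffProb) / Real.log 3))
    (fun c => by
      rw [← gasketOp_smul]
      exact tendsto_posRealTrace_gasketOp (c • f))
  have h1 := integral_posPart_sub f
  -- The real part of -i ∫ f is the imaginary part of ∫ f.
  have h2 := integral_posPart_sub ((-Complex.I) • f)
  have h3 : (∫ x, ((-Complex.I) • f) x ∂hausdorffProb).re = (∫ x, f x ∂hausdorffProb).im := by
    simp only [ContinuousMap.smul_apply]
    rw [integral_smul]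
    simp
  rw [h3] at h2
  simp only [ContinuousMap.smul_apply, smul_eq_mul, neg_mul, one_mul, Complex.neg_re, neg_neg]
    at h h2
  rw [tau, h, ← mul_sub, ← mul_sub, ← sub_div, ← sub_div, h1, h2]
  conv_rhs => rw [← Complex.re_add_im (∫ x, f x ∂hausdorffProb)]
  push_cast
  ring

end GasketTrace

end SG
end

theorem theorem8p7 (ω : SG.DixmierLimit) :
    IsProbabilityMeasure SG.hausdorffProb ∧
    ∀ f : C(SG.gasket, ℂ),
      SG.MemDixmierIdeal (SG.gasketOp f) ∧
      SG.tau ω f =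
        ((4 / Real.log 3 : ℝ) : ℂ) * riemannZeta ((Real.log 3 / Real.log 2 : ℝ) : ℂ) *
          ∫ x, f x ∂SG.hausdorffProb ∧
      SG.tau ω f =
        ((4 / Real.log 3 : ℝ) : ℂ) * riemannZeta ((Real.log 3 / Real.log 2 : ℝ) : ℂ) *
          SG.psi f := by
  refine ⟨inferInstance, fun f => ⟨SG.memDixmierIdeal_gasketOp f, ?_, ?_⟩⟩
  · rw [SG.riemannZeta_gasketDim]
    exact SG.tau_eq ω f
  · rw [SG.riemannZeta_gasketDim]
    exact SG.tau_eq ω f
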